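/- Let $M\subset\mathbb{C}^3$ be a real-analytic real hypersurface (of real dimension $5$). For $p\in M$ let $\mathfrak{hol}(M,p)$ be the real Lie algebra of germs at $p$ of holomorphic vector fields $X=\sum_{k=1}^{3}a_k(z)\,\partial_{z_k}$ such that $X+\overline X$ is tangent to $M$ at all points of $M$ near $p$. Suppose that $M$ is (i) holomorphically simply-transitive: for every $p\in M$ the evaluation map $\mathfrak{hol}(M,p)\to T_pM$, $X\mapsto (X+\overline X)|_p$, is surjective, and $\dim_{\mathbb R}\mathfrak{hol}(M,p)=5=\dim M$; and (ii) Levi non-degenerate at every point. Let $p\in M$ be such that the Lie algebra $\mathfrak{hol}(M,p)$ contains a $3$-dimensional abelian ideal. Then, near $p$, $M$ is a tube on an affinely simply-transitive base: there are a connected real-analytic surface $\mathcal S\subset\mathbb R^3$ and a biholomorphism $\varphi:U\to V$ between open subsets of $\mathbb{C}^3$ with $p\in U$ and $\varphi(M\cap U)=M_{\mathcal S}\cap V$, where $M_{\mathcal S}=\{z\in\mathbb C^3:\operatorname{Re}z\in\mathcal S\}$, such that $\mathcal S$ is affinely simply-transitive. The latter means that, for the space $\mathfrak{aff}(\mathcal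 S)$ of real affine vector fields $\sum_k\big(\sum_\ell A_{k\ell}x_\ell+b_k\big)\partial_{x_k}$ on $\mathbb R^3$ that are everywhere tangent to $\mathcal S$, the evaluation map $\mathfrak{aff}(\mathcal S)\to T_x\mathcal S$ is surjective for every $x\in\mathcal S$, and $\dim_{\mathbb R}\mathfrak{aff}(\mathcal S)=2=\dim\mathcal S$. -/

import Mathlib

open Filter Topology

/-- Real-analytic function germ `r` at `p` defining the set `M` near `p`, with nonzero
differential at `p`. -/
def IsLocalDefiningFunction {E : Type*} [NormedAddCommGroup E] [NormedSpace ℝ E]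
    (M : Set E) (p : E) (r : E → ℝ) : Prop :=
  AnalyticAt ℝ r p ∧ fderiv ℝ r p ≠ 0 ∧ ∀ᶠ q in 𝓝 p, (q ∈ M ↔ r q = 0)

/-- `M` is an (embedded, not necessarily closed) real-analytic real hypersurface of `E`. -/
def IsAnalyticHypersurface {E : Type*} [NormedAddCommGroup E] [NormedSpace ℝ E]
    (M : Set E) : Prop :=
  ∀ p ∈ M, ∃ r : E → ℝ, IsLocalDefiningFunction M p r

/-- The tangent space at `q` of a real-analytic submanifold `M`: the vectors killed by the
differentials of all analytic function germs at `q` that vanish on `M`. For a hypersurface with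
local defining function `r` this is the kernel of `dr` at `q`. -/
def tangentSpaceAt {E : Type*} [NormedAddCommGroup E] [NormedSpace ℝ E]
    (M : Set E) (q : E) : Submodule ℝ E where
  carrier := {v | ∀ f : E → ℝ, AnalyticAt ℝ f q → (∀ᶠ x in 𝓝 q, x ∈ M → f x = 0) →
    fderiv ℝ f q v = 0}
  add_mem' := fun hv hw f hf h0 => by rw [map_add, hv f hf h0, hw f hf h0, add_zero]
  zero_mem' := fun f _ _ => map_zero _
  smul_mem' := fun c v hv f hf h0 => by rw [map_smul, hv f hf h0, smul_zero]

/-- The hypersurface `M ⊂ ℂ³` is Levi non-degenerate at `p`: for a defining function `r` with real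
Hessian `B` at `p`, the form `B(v,w) + B(iv,iw)` (which is `4 Re ∑ r_{z_j z̄_k} v_j w̄_k`) is
non-degenerate on the complex tangent space `T_pM ∩ i T_pM`. A Hermitian form is non-degenerate if
and only if its real part is, and the condition does not depend on the choice of `r`. -/
def IsLeviNondegenerateAt (M : Set (Fin 3 → ℂ)) (p : Fin 3 → ℂ) : Prop :=
  ∃ r : (Fin 3 → ℂ) → ℝ, IsLocalDefiningFunction M p r ∧
    ∀ v : Fin 3 → ℂ, fderiv ℝ r p v = 0 → fderiv ℝ r p (Complex.I • v) = 0 →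
      (∀ w : Fin 3 → ℂ, fderiv ℝ r p w = 0 → fderiv ℝ r p (Complex.I • w) = 0 →
        fderiv ℝ (fderiv ℝ r) p v w
          + fderiv ℝ (fderiv ℝ r) p (Complex.I • v) (Complex.I • w) = 0) →
      v = 0

/-- The real vector space of germs at `p` of holomorphic vector fields
`X = ∑ a_k(z) ∂/∂z_k` on `ℂ³`, where `X` is given by its coefficient vector `(a_1, a_2, a_3)`. -/
def HolVectorField (p : Fin 3 → ℂ) : Submodule ℝ (Germ (𝓝 p) (Fin 3 → ℂ)) where
  carrier := {g | ∃ X : (Fin 3 → ℂ) → (Fin 3 → ℂ), AnalyticAt ℂ X p ∧ (X : Germ (𝓝 p) _) = g}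
  add_mem' := by
    rintro _ _ ⟨X, hX, rfl⟩ ⟨Y, hY, rfl⟩
    exact ⟨X + Y, hX.add hY, rfl⟩
  zero_mem' := ⟨0, analyticAt_const, rfl⟩
  smul_mem' := by
    rintro c _ ⟨X, hX, rfl⟩
    exact ⟨c • X, hX.const_smul, rfl⟩

namespace HolVectorField

open VectorField

variable {p : Fin 3 → ℂ}

/-- The Lie bracket of vector fields, on germs. -/
noncomputable def germBracket (g h : Germ (𝓝 p) (Fin 3 → ℂ)) : Germ (𝓝 p) (Fin 3 → ℂ) :=
  Quotient.map₂ (fun X Y => lieBracket ℂ X Y)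
    (fun _ _ hX _ _ hY => Filter.EventuallyEq.lieBracket_vectorField hX hY) g h

theorem germBracket_coe (X Y : (Fin 3 → ℂ) → (Fin 3 → ℂ)) :
    germBracket (X : Germ (𝓝 p) (Fin 3 → ℂ)) (Y : Germ (𝓝 p) (Fin 3 → ℂ))
      = ((lieBracket ℂ X Y : (Fin 3 → ℂ) → (Fin 3 → ℂ)) : Germ (𝓝 p) (Fin 3 → ℂ)) := rfl

theorem analyticAt_lieBracket {X Y : (Fin 3 → ℂ) → (Fin 3 → ℂ)}
    (hX : AnalyticAt ℂ X p) (hY : AnalyticAt ℂ Y p) : AnalyticAt ℂ (lieBracket ℂ X Y) p := by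
  have h : ContDiffAt ℂ ⊤ (lieBracket ℂ X Y) p :=
    ContDiffAt.lieBracket_vectorField (n := ⊤) hX.contDiffAt hY.contDiffAt le_rfl
  exact h.analyticAt

noncomputable instance : Bracket (HolVectorField p) (HolVectorField p) where
  bracket g h := ⟨germBracket g.1 h.1, by
    obtain ⟨_, X, hX, rfl⟩ := g
    obtain ⟨_, Y, hY, rfl⟩ := h
    exact ⟨lieBracket ℂ X Y, analyticAt_lieBracket hX hY, rfl⟩⟩

theorem coe_bracket (g h : HolVectorField p) :
    ((⁅g, h⁆ : HolVectorField p) : Germ (𝓝 p) (Fin 3 → ℂ)) = germBracket g.1 h.1 := rfl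

theorem eventually_differentiableAt {X : (Fin 3 → ℂ) → (Fin 3 → ℂ)} (hX : AnalyticAt ℂ X p) :
    ∀ᶠ q in 𝓝 p, DifferentiableAt ℂ X q :=
  hX.eventually_analyticAt.mono fun _ h => h.differentiableAt

noncomputable instance : LieRing (HolVectorField p) where
  add_lie := by
    rintro ⟨_, X, hX, rfl⟩ ⟨_, Y, hY, rfl⟩ ⟨_, Z, hZ, rfl⟩
    refine Subtype.ext (Germ.coe_eq.2 ?_)
    filter_upwards [eventually_differentiableAt hX, eventually_differentiableAt hY] with q h1 h2
    exact lieBracket_add_left h1 h2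
  lie_add := by
    rintro ⟨_, X, hX, rfl⟩ ⟨_, Y, hY, rfl⟩ ⟨_, Z, hZ, rfl⟩
    refine Subtype.ext (Germ.coe_eq.2 ?_)
    filter_upwards [eventually_differentiableAt hY, eventually_differentiableAt hZ] with q h1 h2
    exact lieBracket_add_right h1 h2
  lie_self := by
    rintro ⟨_, X, hX, rfl⟩
    refine Subtype.ext (Germ.coe_eq.2 ?_)
    filter_upwards with q
    rw [lieBracket_self]
    rfl
  leibniz_lie := by
    rintro ⟨_, X, hX, rfl⟩ ⟨_, Y, hY, rfl⟩ ⟨_, Z, hZ, rfl⟩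
    refine Subtype.ext (Germ.coe_eq.2 ?_)
    filter_upwards [hX.eventually_analyticAt, hY.eventually_analyticAt,
      hZ.eventually_analyticAt] with q h1 h2 h3
    exact leibniz_identity_lieBracket (n := minSmoothness ℂ 2) le_rfl
      h1.contDiffAt h2.contDiffAt h3.contDiffAt

noncomputable instance : LieAlgebra ℝ (HolVectorField p) where
  lie_smul := by
    rintro c ⟨_, X, hX, rfl⟩ ⟨_, Y, hY, rfl⟩
    refine Subtype.ext (Germ.coe_eq.2 ?_)
    filter_upwards [eventually_differentiableAt hY] with q h1
    exact lieBracket_const_smul_right (c := (c : ℂ)) h1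

theorem lieBracket_complex_eq_real {X Y : (Fin 3 → ℂ) → (Fin 3 → ℂ)} {q : Fin 3 → ℂ}
    (hX : DifferentiableAt ℂ X q) (hY : DifferentiableAt ℂ Y q) :
    lieBracket ℂ X Y q = lieBracket ℝ X Y q := by
  simp only [lieBracket_eq]
  rw [hX.fderiv_restrictScalars ℝ, hY.fderiv_restrictScalars ℝ]
  rfl

end HolVectorField

/-- A holomorphic vector field `X` on `ℂ³`, seen as the real vector field `X + X̄` with value
`X(q) ∈ ℂ³ = ℝ⁶` at `q`, is tangent to `M` along `M` near `p`. -/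
def IsTangentNear (M : Set (Fin 3 → ℂ)) (p : Fin 3 → ℂ)
    (X : (Fin 3 → ℂ) → (Fin 3 → ℂ)) : Prop :=
  ∀ᶠ q in 𝓝 p, q ∈ M → X q ∈ tangentSpaceAt M q

theorem IsTangentNear.lieBracket {M : Set (Fin 3 → ℂ)} {p : Fin 3 → ℂ}
    {X Y : (Fin 3 → ℂ) → (Fin 3 → ℂ)} (hXa : AnalyticAt ℂ X p) (hYa : AnalyticAt ℂ Y p)
    (hX : IsTangentNear M p X) (hY : IsTangentNear M p Y) :
    IsTangentNear M p (VectorField.lieBracket ℂ X Y) := by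
  filter_upwards [hX.eventually_nhds, hY.eventually_nhds, hXa.eventually_analyticAt,
    hYa.eventually_analyticAt] with q hXq hYq hXaq hYaq hq f hf h0
  have hf0 : ∀ {Z : (Fin 3 → ℂ) → (Fin 3 → ℂ)},
      (∀ᶠ y in 𝓝 q, y ∈ M → Z y ∈ tangentSpaceAt M y) →
      ∀ᶠ y in 𝓝 q, y ∈ M → fderiv ℝ f y (Z y) = 0 := by
    intro Z hZ
    filter_upwards [hZ, hf.eventually_analyticAt, h0.eventually_nhds] with y hZy hfy h0y hy
    exact hZy hy f hfy h0y
  have han : ∀ {Z : (Fin 3 → ℂ) → (Fin 3 → ℂ)}, AnalyticAt ℂ Z q →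
      AnalyticAt ℝ (fun y => fderiv ℝ f y (Z y)) q := by
    intro Z hZ
    have h : ContDiffAt ℝ ⊤ (fun y => fderiv ℝ f y (Z y)) q :=
      ContDiffAt.clm_apply hf.fderiv.contDiffAt (AnalyticAt.restrictScalars hZ).contDiffAt
    exact h.analyticAt
  rw [HolVectorField.lieBracket_complex_eq_real hXaq.differentiableAt hYaq.differentiableAt,
    VectorField.fderiv_apply_lieBracket (n := minSmoothness ℝ 2) hf.contDiffAt le_rfl
      hYaq.restrictScalars.differentiableAt hXaq.restrictScalars.differentiableAt,
    hXq.self_of_nhds hq _ (han hYaq) (hf0 hYq), hYq.self_of_nhds hq _ (han hXaq) (hf0 hXq),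
    sub_zero]

/-- The real Lie algebra `𝔥𝔬𝔩(M)` of infinitesimal holomorphic symmetries of `M` at `p`: germs at
`p` of holomorphic vector fields `X` on `ℂ³` such that `X + X̄` is tangent to `M` along `M`. -/
noncomputable def hol (M : Set (Fin 3 → ℂ)) (p : Fin 3 → ℂ) :
    LieSubalgebra ℝ (HolVectorField p) where
  carrier := {g | ∃ X : (Fin 3 → ℂ) → (Fin 3 → ℂ), AnalyticAt ℂ X p ∧ IsTangentNear M p X ∧
    (X : Germ (𝓝 p) _) = g.1}
  add_mem' := by
    rintro ⟨_, _⟩ ⟨_, _⟩ ⟨X, hXa, hX, rfl⟩ ⟨Y, hYa, hY, rfl⟩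
    refine ⟨X + Y, hXa.add hYa, ?_, rfl⟩
    filter_upwards [hX, hY] with q h1 h2 hq
    exact add_mem (h1 hq) (h2 hq)
  zero_mem' := ⟨0, analyticAt_const, Eventually.of_forall fun _ _ => zero_mem _, rfl⟩
  smul_mem' := by
    rintro c ⟨_, _⟩ ⟨X, hXa, hX, rfl⟩
    refine ⟨c • X, hXa.const_smul, ?_, rfl⟩
    filter_upwards [hX] with q h1 hq
    exact Submodule.smul_mem _ c (h1 hq)
  lie_mem' := by
    rintro ⟨_, _⟩ ⟨_, _⟩ ⟨X, hXa, hX, rfl⟩ ⟨Y, hYa, hY, rfl⟩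
    exact ⟨VectorField.lieBracket ℂ X Y, HolVectorField.analyticAt_lieBracket hXa hYa,
      hX.lieBracket hXa hYa hY, rfl⟩

/-- `M⁵ ⊂ ℂ³` is (locally) holomorphically simply-transitive: at every `p ∈ M` the evaluation
`𝔥𝔬𝔩(M) → T_pM` is onto, and `dim 𝔥𝔬𝔩(M) = 5 = dim M`. -/
def IsHolSimplyTransitive (M : Set (Fin 3 → ℂ)) : Prop :=
  ∀ p ∈ M, (∀ v ∈ tangentSpaceAt M p, ∃ X ∈ hol M p, X.1.value = v) ∧
    Module.finrank ℝ (hol M p) = 5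

/-- The affine symmetry algebra of `S ⊂ ℝ³`: affine vector fields `x ↦ A x + b` that are everywhere
tangent to `S`. -/
def affSymmetries (S : Set (Fin 3 → ℝ)) : Submodule ℝ ((Fin 3 → ℝ) →ᵃ[ℝ] (Fin 3 → ℝ)) where
  carrier := {A | ∀ x ∈ S, A x ∈ tangentSpaceAt S x}
  add_mem' := fun hA hB x hx => add_mem (hA x hx) (hB x hx)
  zero_mem' := fun _ _ => zero_mem _
  smul_mem' := fun c _ hA x hx => Submodule.smul_mem _ c (hA x hx)

/-- The surface `S ⊂ ℝ³` is affinely simply-transitive: `𝔞𝔣𝔣(S) → T_xS` is onto for every `x ∈ S`,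
and `dim 𝔞𝔣𝔣(S) = 2 = dim S`. -/
def IsAffSimplyTransitive (S : Set (Fin 3 → ℝ)) : Prop :=
  (∀ x ∈ S, ∀ v ∈ tangentSpaceAt S x, ∃ A ∈ affSymmetries S, A x = v) ∧
    Module.finrank ℝ (affSymmetries S) = 2

/-- The tube `S + iℝ³ ⊂ ℂ³` with base `S ⊂ ℝ³`. -/
def tubeOver (S : Set (Fin 3 → ℝ)) : Set (Fin 3 → ℂ) :=
  {z | (fun k => (z k).re) ∈ S}

/-- Near `p`, some biholomorphism between open subsets of `ℂ³` maps `M` onto `N`. -/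
def IsLocallyBiholomorphicAt (M N : Set (Fin 3 → ℂ)) (p : Fin 3 → ℂ) : Prop :=
  ∃ φ : OpenPartialHomeomorph (Fin 3 → ℂ) (Fin 3 → ℂ), p ∈ φ.source ∧
    DifferentiableOn ℂ φ φ.source ∧ DifferentiableOn ℂ φ.symm φ.target ∧
    φ '' (M ∩ φ.source) = N ∩ φ.target

/-! Let `𝔞` be the abelian ideal and complexify: pairs `x = U + iV`, `x' = U - iV` with `U, V ∈
𝔞` play the role of complex conjugates. The main point is that the values of `𝔞` at `p` are
totally real. If not, some `x` vanishes at `p` while `x'` does not, and Levi non-degeneracy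
supplies a pair `y`, `y'` of symmetries, again with `y(p) = 0`, for which `R := [y', x]` can be
arranged to be, up to a multiple of `x`, a real element of `𝔞` transversal to the complex
tangent space. The Jacobi identity determines the remaining structure constants well enough to
integrate the bracket relations in the frame `x', R, y'`: they give `x = c R - b c² x'` with `b`
real, `c` holomorphic and `c(p) = 0`. But then `c x'` is a symmetry of `M` vanishing at `p`, so
it is zero by simple transitivity, hence so is `x`, which is absurd.

Total reality lets one rectify a basis of `𝔞` to `i ∂/∂z₁, i ∂/∂z₂, i ∂/∂z₃`, which makes `M` a tube
over some surface. Every symmetry normalises `𝔞`, so in these coordinates it is affine with real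
linear part; hence `𝔥𝔬𝔩(M) = iℝ³ ⊕ 𝔞𝔣𝔣(S)`, and counting dimensions, `5 = 3 + 2`. -/

open scoped ComplexConjugate

namespace HolVectorField

variable {p : Fin 3 → ℂ}

noncomputable instance : SMul ℂ (HolVectorField p) where
  smul c g := ⟨c • g.1, by
    obtain ⟨_, X, hX, rfl⟩ := g
    exact ⟨c • X, hX.const_smul, rfl⟩⟩

noncomputable instance : Module ℂ (HolVectorField p) :=
  Function.Injective.module ℂ (HolVectorField p).subtype.toAddMonoidHom
    Subtype.val_injective fun _ _ => rfl

instance : IsScalarTower ℝ ℂ (HolVectorField p) where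
  smul_assoc := by
    rintro a b ⟨_, X, hX, rfl⟩
    refine Subtype.ext (Germ.coe_eq.2 (Eventually.of_forall fun q => ?_))
    exact smul_assoc a b (X q)

noncomputable instance : LieAlgebra ℂ (HolVectorField p) where
  lie_smul := by
    rintro c ⟨_, X, hX, rfl⟩ ⟨_, Y, hY, rfl⟩
    refine Subtype.ext (Germ.coe_eq.2 ?_)
    filter_upwards [eventually_differentiableAt hY] with q hYq
    exact VectorField.lieBracket_const_smul_right hYq

/-- Evaluation at `p` of germs of holomorphic vector fields. -/
noncomputable def eval : HolVectorField p →ₗ[ℂ] (Fin 3 → ℂ) where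
  toFun g := g.1.value
  map_add' := by
    rintro ⟨_, X, hX, rfl⟩ ⟨_, Y, hY, rfl⟩
    rfl
  map_smul' := by
    rintro c ⟨_, X, hX, rfl⟩
    rfl

/-- A vector field representing a germ; only its behaviour near `p` is meaningful. -/
noncomputable def rep (g : HolVectorField p) : (Fin 3 → ℂ) → (Fin 3 → ℂ) := g.2.choose

theorem analyticAt_rep (g : HolVectorField p) : AnalyticAt ℂ (rep g) p := g.2.choose_spec.1

theorem coe_rep (g : HolVectorField p) : (rep g : Germ (𝓝 p) (Fin 3 → ℂ)) = g.1 :=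
  g.2.choose_spec.2

/-- The germ at `p` of a vector field analytic at `p`. -/
noncomputable def ofAnalytic (X : (Fin 3 → ℂ) → (Fin 3 → ℂ)) (hX : AnalyticAt ℂ X p) :
    HolVectorField p :=
  ⟨(X : Germ (𝓝 p) (Fin 3 → ℂ)), X, hX, rfl⟩

theorem rep_eventuallyEq {g : HolVectorField p} {X : (Fin 3 → ℂ) → (Fin 3 → ℂ)}
    (h : (X : Germ (𝓝 p) (Fin 3 → ℂ)) = g.1) : rep g =ᶠ[𝓝 p] X :=
  Germ.coe_eq.1 ((coe_rep g).trans h.symm)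

theorem rep_ofAnalytic {X : (Fin 3 → ℂ) → (Fin 3 → ℂ)} (hX : AnalyticAt ℂ X p) :
    rep (ofAnalytic X hX) =ᶠ[𝓝 p] X :=
  rep_eventuallyEq rfl

theorem eq_of_rep_eventuallyEq {g h : HolVectorField p} (H : rep g =ᶠ[𝓝 p] rep h) : g = h :=
  Subtype.ext (by rw [← coe_rep g, ← coe_rep h]; exact Germ.coe_eq.2 H)

theorem rep_self (g : HolVectorField p) : rep g p = eval g := by
  change _ = g.1.value
  rw [← coe_rep g]
  rfl

theorem rep_add (g h : HolVectorField p) : rep (g + h) =ᶠ[𝓝 p] fun q => rep g q + rep h q :=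
  rep_eventuallyEq (by
    change _ = g.1 + h.1
    rw [← coe_rep g, ← coe_rep h]
    rfl)

theorem rep_smul (c : ℂ) (g : HolVectorField p) : rep (c • g) =ᶠ[𝓝 p] fun q => c • rep g q :=
  rep_eventuallyEq (by
    change _ = c • g.1
    rw [← coe_rep g]
    rfl)

theorem rep_zero : rep (0 : HolVectorField p) =ᶠ[𝓝 p] fun _ => 0 :=
  rep_eventuallyEq rfl

theorem rep_sub (g h : HolVectorField p) : rep (g - h) =ᶠ[𝓝 p] fun q => rep g q - rep h q :=
  rep_eventuallyEq (by
    change _ = g.1 - h.1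
    rw [← coe_rep g, ← coe_rep h]
    rfl)

theorem rep_lie (g h : HolVectorField p) :
    rep ⁅g, h⁆ =ᶠ[𝓝 p] VectorField.lieBracket ℂ (rep g) (rep h) :=
  rep_eventuallyEq (by rw [coe_bracket, ← coe_rep g, ← coe_rep h]; rfl)

theorem eval_lie (g h : HolVectorField p) :
    eval ⁅g, h⁆ = fderiv ℂ (rep h) p (eval g) - fderiv ℂ (rep g) p (eval h) := by
  rw [← rep_self, (rep_lie g h).self_of_nhds, VectorField.lieBracket, rep_self, rep_self]

theorem eval_lie_eq_zero {g h : HolVectorField p} (hg : eval g = 0) (hh : eval h = 0) :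
    eval ⁅g, h⁆ = 0 := by
  rw [eval_lie, hg, hh, map_zero, map_zero, sub_zero]

theorem fderiv_rep_add_smul (c : ℂ) (g h : HolVectorField p) :
    fderiv ℂ (rep (g + c • h)) p = fderiv ℂ (rep g) p + c • fderiv ℂ (rep h) p := by
  have hrep : rep (g + c • h) =ᶠ[𝓝 p] rep g + c • rep h := by
    filter_upwards [rep_add g (c • h), rep_smul c h] with q hadd hsmul
    rw [hadd, hsmul]
    rfl
  have hg := (analyticAt_rep g).differentiableAt
  have hh := (analyticAt_rep h).differentiableAt
  rw [hrep.fderiv_eq, fderiv_add hg (hh.const_smul c), fderiv_const_smul hh]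

end HolVectorField

section Hypersurface

variable {E : Type*} [NormedAddCommGroup E] [NormedSpace ℝ E] {M : Set E} {p : E} {r : E → ℝ}

theorem IsLocalDefiningFunction.mem_tangentSpaceAt_iff [CompleteSpace E]
    (hr : IsLocalDefiningFunction M p r) (hp : p ∈ M) {v : E} :
    v ∈ tangentSpaceAt M p ↔ fderiv ℝ r p v = 0 := by
  obtain ⟨hra, hr0, hrM⟩ := hr
  refine ⟨fun hv => hv r hra (hrM.mono fun q hq => hq.1), fun hv f hf hfM => ?_⟩
  have hrp : r p = 0 := hrM.self_of_nhds.1 hp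
  have hext : IsLocalExtrOn f {x | r x = r p} p := by
    left
    change ∀ᶠ x in 𝓝[{x | r x = r p}] p, f p ≤ f x
    rw [eventually_nhdsWithin_iff]
    filter_upwards [hrM, hfM] with q hqM hfq hrq
    rw [hfq (hqM.2 (hrq.trans hrp)), hfM.self_of_nhds hp]
  obtain ⟨a, b, hab, hlagrange⟩ := hext.exists_multipliers_of_hasStrictFDerivAt_1d
    hra.hasStrictFDerivAt hf.hasStrictFDerivAt
  have hb : b ≠ 0 := by
    rintro rfl
    have ha : a ≠ 0 := by rintro rfl; exact hab rfl
    simp only [zero_smul, add_zero, smul_eq_zero] at hlagrange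
    exact hlagrange.elim ha hr0
  have hbv := congrArg (fun l => l v) hlagrange
  simp only [add_apply, smul_apply, hv, smul_zero, zero_add, zero_apply] at hbv
  exact (smul_eq_zero.1 hbv).resolve_left hb

theorem IsLocalDefiningFunction.eventually (hr : IsLocalDefiningFunction M p r) :
    ∀ᶠ q in 𝓝 p, IsLocalDefiningFunction M q r := by
  obtain ⟨hra, hr0, hrM⟩ := hr
  filter_upwards [hra.eventually_analyticAt, hrM.eventually_nhds,
    hra.fderiv.continuousAt.eventually_ne hr0] with q hqa hqM hq0
  exact ⟨hqa, hq0, hqM⟩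

theorem IsLocalDefiningFunction.finrank_tangentSpaceAt [FiniteDimensional ℝ E]
    (hr : IsLocalDefiningFunction M p r) (hp : p ∈ M) :
    Module.finrank ℝ (tangentSpaceAt M p) + 1 = Module.finrank ℝ E := by
  have : CompleteSpace E := FiniteDimensional.complete ℝ E
  have hker : tangentSpaceAt M p = LinearMap.ker (fderiv ℝ r p : E →ₗ[ℝ] ℝ) := by
    ext v
    exact hr.mem_tangentSpaceAt_iff hp
  rw [hker]
  exact Module.Dual.finrank_ker_add_one_of_ne_zero (f := (fderiv ℝ r p : E →ₗ[ℝ] ℝ))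
    fun h0 => hr.2.1 (ContinuousLinearMap.coe_injective h0)

end Hypersurface

section HolDifferential

variable {E : Type*} [NormedAddCommGroup E] [NormedSpace ℝ E] [NormedSpace ℂ E]
  [IsScalarTower ℝ ℂ E]

/-- The complex-linear form `2 ∂r` at `q`: its real part is `dr`, and its kernel is the complex
tangent space at `q` of the level set of `r`. -/
noncomputable def holDifferential (r : E → ℝ) (q : E) : E →ₗ[ℂ] ℂ :=
  Module.Dual.extendRCLike (fderiv ℝ r q).toLinearMap

theorem re_holDifferential (r : E → ℝ) (q v : E) :
    (holDifferential r q v).re = fderiv ℝ r q v :=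
  Module.Dual.re_extendRCLike_apply (𝕜 := ℂ) (fderiv ℝ r q).toLinearMap v

theorem im_holDifferential (r : E → ℝ) (q v : E) :
    (holDifferential r q v).im = -fderiv ℝ r q (Complex.I • v) :=
  Module.Dual.im_extendRCLike_apply (𝕜 := ℂ) (fderiv ℝ r q).toLinearMap v

theorem holDifferential_eq_zero_iff {r : E → ℝ} {q v : E} :
    holDifferential r q v = 0 ↔ fderiv ℝ r q v = 0 ∧ fderiv ℝ r q (Complex.I • v) = 0 := by
  rw [Complex.ext_iff, re_holDifferential, im_holDifferential, Complex.zero_re, Complex.zero_im,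
    neg_eq_zero]

/-- The real part of the Levi form of `r` at `p`, up to a factor `4`, in the normalisation of
`IsLeviNondegenerateAt`. -/
noncomputable def leviForm (r : E → ℝ) (p v w : E) : ℝ :=
  fderiv ℝ (fderiv ℝ r) p v w + fderiv ℝ (fderiv ℝ r) p (Complex.I • v) (Complex.I • w)

end HolDifferential

theorem IsLeviNondegenerateAt.exists_leviForm_ne_zero {M : Set (Fin 3 → ℂ)} {p : Fin 3 → ℂ}
    (hLevi : IsLeviNondegenerateAt M p) :
    ∃ r : (Fin 3 → ℂ) → ℝ, IsLocalDefiningFunction M p r ∧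
      ∀ v ≠ 0, holDifferential r p v = 0 →
        ∃ w, holDifferential r p w = 0 ∧ leviForm r p v w ≠ 0 := by
  obtain ⟨r, hr, hL⟩ := hLevi
  refine ⟨r, hr, fun v hv0 hv => ?_⟩
  by_contra! hdeg
  rw [holDifferential_eq_zero_iff] at hv
  exact hv0 (hL v hv.1 hv.2 fun w hw hIw => hdeg w (holDifferential_eq_zero_iff.2 ⟨hw, hIw⟩))

/-- Holomorphic simple transitivity at the single point `p`. -/
def IsHolSimplyTransitiveAt (M : Set (Fin 3 → ℂ)) (p : Fin 3 → ℂ) : Prop :=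
  (∀ v ∈ tangentSpaceAt M p, ∃ X ∈ hol M p, X.1.value = v) ∧ Module.finrank ℝ (hol M p) = 5

section Hol

open HolVectorField

variable {M : Set (Fin 3 → ℂ)} {p : Fin 3 → ℂ} {r : (Fin 3 → ℂ) → ℝ}

theorem mem_hol_iff (hr : IsLocalDefiningFunction M p r) {g : HolVectorField p}
    {X : (Fin 3 → ℂ) → (Fin 3 → ℂ)} (hX : rep g =ᶠ[𝓝 p] X) :
    g ∈ hol M p ↔ ∀ᶠ q in 𝓝 p, q ∈ M → fderiv ℝ r q (X q) = 0 := by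
  constructor
  · rintro ⟨Y, -, hYt, hYg⟩
    filter_upwards [hr.eventually, hYt, hX, rep_eventuallyEq hYg] with q hrq hYq hXq hgq hq
    rw [← hXq, hgq]
    exact (hrq.mem_tangentSpaceAt_iff hq).1 (hYq hq)
  · intro h
    refine ⟨rep g, analyticAt_rep g, ?_, coe_rep g⟩
    filter_upwards [hr.eventually, h, hX] with q hrq hXq hgq hq
    rw [hgq]
    exact (hrq.mem_tangentSpaceAt_iff hq).2 (hXq hq)

theorem eventually_fderiv_rep_eq_zero (hr : IsLocalDefiningFunction M p r) {g : HolVectorField p}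
    (hg : g ∈ hol M p) : ∀ᶠ q in 𝓝 p, q ∈ M → fderiv ℝ r q (rep g q) = 0 :=
  (mem_hol_iff hr EventuallyEq.rfl).1 hg

theorem fderiv_eval_eq_zero (hr : IsLocalDefiningFunction M p r) (hp : p ∈ M)
    {g : HolVectorField p} (hg : g ∈ hol M p) : fderiv ℝ r p (eval g) = 0 := by
  rw [← rep_self]
  exact (eventually_fderiv_rep_eq_zero hr hg).self_of_nhds hp

theorem IsHolSimplyTransitiveAt.exists_eval_eq (hst : IsHolSimplyTransitiveAt M p)
    (hr : IsLocalDefiningFunction M p r) (hp : p ∈ M) {v : Fin 3 → ℂ} (hv : fderiv ℝ r p v = 0) :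
    ∃ g ∈ hol M p, eval g = v :=
  hst.1 v ((hr.mem_tangentSpaceAt_iff hp).2 hv)

theorem IsHolSimplyTransitiveAt.eq_zero_of_eval_eq_zero (hst : IsHolSimplyTransitiveAt M p)
    (hr : IsLocalDefiningFunction M p r) (hp : p ∈ M) {g : HolVectorField p}
    (hg : g ∈ hol M p) (h0 : eval g = 0) : g = 0 := by
  let ev : hol M p →ₗ[ℝ] tangentSpaceAt M p :=
    ((eval.restrictScalars ℝ).comp (hol M p).toSubmodule.subtype).codRestrict _
      fun g => (hr.mem_tangentSpaceAt_iff hp).2 (fderiv_eval_eq_zero hr hp g.2)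
  have hsurj : Function.Surjective ev := by
    rintro ⟨v, hv⟩
    obtain ⟨X, hX, hXv⟩ := hst.1 v hv
    exact ⟨⟨X, hX⟩, Subtype.ext hXv⟩
  have : Module.Finite ℝ (hol M p) := Module.finite_of_finrank_pos (by rw [hst.2]; norm_num)
  have hdim : Module.finrank ℝ (hol M p) = Module.finrank ℝ (tangentSpaceAt M p) := by
    have hT := hr.finrank_tangentSpaceAt hp
    simp only [Module.finrank_pi_fintype, Complex.finrank_real_complex, Finset.sum_const,
      Finset.card_univ, Fintype.card_fin, smul_eq_mul] at hT
    rw [hst.2]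
    omega
  have hinj : Function.Injective ev :=
    (LinearMap.injective_iff_surjective_of_finrank_eq_finrank hdim).2 hsurj
  exact congrArg Subtype.val (hinj (a₁ := ⟨g, hg⟩) (a₂ := 0) (Subtype.ext h0))

theorem hessian_eval_add_fderiv_rep (hr : IsLocalDefiningFunction M p r) (hp : p ∈ M)
    {g : HolVectorField p} (hg : g ∈ hol M p) {u : Fin 3 → ℂ} (hu : fderiv ℝ r p u = 0) :
    fderiv ℝ (fderiv ℝ r) p (eval g) u + fderiv ℝ r p (fderiv ℂ (rep g) p u) = 0 := by
  have hga : AnalyticAt ℝ (rep g) p := (analyticAt_rep g).restrictScalars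
  have han : AnalyticAt ℝ (fun q => fderiv ℝ r q (rep g q)) p :=
    (ContDiffAt.clm_apply (n := ⊤) hr.1.fderiv.contDiffAt hga.contDiffAt).analyticAt
  have hder := (hr.mem_tangentSpaceAt_iff hp).2 hu _ han (eventually_fderiv_rep_eq_zero hr hg)
  rw [fderiv_clm_apply hr.1.fderiv.differentiableAt hga.differentiableAt,
    (analyticAt_rep g).differentiableAt.fderiv_restrictScalars ℝ, rep_self] at hder
  have hsymm : fderiv ℝ (fderiv ℝ r) p (eval g) u = fderiv ℝ (fderiv ℝ r) p u (eval g) :=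
    (hr.1.contDiffAt (n := ⊤)).isSymmSndFDerivAt (by simp) _ _
  rw [hsymm, add_comm]
  simpa using hder

theorem fderiv_eval_lie_eq_neg_leviForm (hr : IsLocalDefiningFunction M p r) (hp : p ∈ M)
    {U V Y : HolVectorField p} (hU : U ∈ hol M p) (hV : V ∈ hol M p)
    (hUV : eval V = Complex.I • eval U) (hY : holDifferential r p (eval Y) = 0) :
    fderiv ℝ r p (eval ⁅Y, U + Complex.I • V⁆) = -leviForm r p (eval U) (eval Y) := by
  obtain ⟨hY, hIY⟩ := holDifferential_eq_zero_iff.1 hY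
  have hnull : eval (U + Complex.I • V) = 0 := by
    rw [map_add, map_smul, hUV, smul_smul, Complex.I_mul_I, neg_one_smul, add_neg_cancel]
  have hdU := hessian_eval_add_fderiv_rep hr hp hU hY
  have hdV := hessian_eval_add_fderiv_rep hr hp hV hIY
  rw [eval_lie, hnull, map_zero, sub_zero, fderiv_rep_add_smul, add_apply, smul_apply, map_add,
    leviForm]
  rw [map_smul (fderiv ℂ (rep V) p), hUV] at hdV
  linarith

end Hol

section ConjPair

variable {L : Type*} [LieRing L] [LieAlgebra ℂ L] [Module ℝ L] {A B : Submodule ℝ L}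
  {x x' y y' : L}

/-- `x` and `x'` are conjugate to each other with respect to the real form `A` of `A + iA`. As a
relation this makes sense without assuming `A ∩ iA = 0`. -/
def IsConjPair (A : Submodule ℝ L) (x x' : L) : Prop :=
  ∃ U ∈ A, ∃ V ∈ A, x = U + Complex.I • V ∧ x' = U - Complex.I • V

namespace IsConjPair

theorem of_mem (hx : x ∈ A) : IsConjPair A x x :=
  ⟨x, hx, 0, A.zero_mem, by rw [smul_zero, add_zero], by rw [smul_zero, sub_zero]⟩

theorem mono (hAB : A ≤ B) (h : IsConjPair A x x') : IsConjPair B x x' := by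
  obtain ⟨U, hU, V, hV, rfl, rfl⟩ := h
  exact ⟨U, hAB hU, V, hAB hV, rfl, rfl⟩

theorem symm (h : IsConjPair A x x') : IsConjPair A x' x := by
  obtain ⟨U, hU, V, hV, rfl, rfl⟩ := h
  exact ⟨U, hU, -V, A.neg_mem hV, by module, by module⟩

theorem add (hx : IsConjPair A x x') (hy : IsConjPair A y y') :
    IsConjPair A (x + y) (x' + y') := by
  obtain ⟨U, hU, V, hV, rfl, rfl⟩ := hx
  obtain ⟨W, hW, W', hW', rfl, rfl⟩ := hy
  exact ⟨U + W, A.add_mem hU hW, V + W', A.add_mem hV hW', by module, by module⟩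

theorem sub (hx : IsConjPair A x x') (hy : IsConjPair A y y') :
    IsConjPair A (x - y) (x' - y') := by
  obtain ⟨U, hU, V, hV, rfl, rfl⟩ := hx
  obtain ⟨W, hW, W', hW', rfl, rfl⟩ := hy
  exact ⟨U - W, A.sub_mem hU hW, V - W', A.sub_mem hV hW', by module, by module⟩

theorem lie (hBA : ∀ b ∈ B, ∀ a ∈ A, ⁅b, a⁆ ∈ A) (hy : IsConjPair B y y')
    (hx : IsConjPair A x x') : IsConjPair A ⁅y, x⁆ ⁅y', x'⁆ := by
  obtain ⟨U, hU, V, hV, rfl, rfl⟩ := hx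
  obtain ⟨W, hW, W', hW', rfl, rfl⟩ := hy
  refine ⟨⁅W, U⁆ - ⁅W', V⁆, A.sub_mem (hBA _ hW _ hU) (hBA _ hW' _ hV),
    ⁅W, V⁆ + ⁅W', U⁆, A.add_mem (hBA _ hW _ hV) (hBA _ hW' _ hU), ?_, ?_⟩ <;>
  simp only [add_lie, lie_add, sub_lie, lie_sub, smul_lie, lie_smul] <;>
  linear_combination (norm := module) Complex.I_mul_I • ⁅W', V⁆

theorem mem (h : IsConjPair A x x) : x ∈ A := by
  obtain ⟨U, hU, V, -, hadd, hsub⟩ := h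
  have hx : (2 : ℝ) • x = (2 : ℝ) • U := by
    rw [two_smul, two_smul]
    nth_rewrite 1 [hadd]
    rw [hsub]
    abel
  rwa [smul_right_injective L (two_ne_zero' ℝ) hx]

theorem smul [IsScalarTower ℝ ℂ L] (c : ℂ) (h : IsConjPair A x x') :
    IsConjPair A (c • x) (conj c • x') := by
  obtain ⟨U, hU, V, hV, rfl, rfl⟩ := h
  have hreal (t : ℝ) (g : L) : t • g = (t : ℂ) • g := (algebraMap_smul ℂ t g).symm
  have hc : c = c.re + c.im * Complex.I := (Complex.re_add_im c).symm
  have hconj : conj c = c.re - c.im * Complex.I := by apply Complex.ext <;> simp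
  refine ⟨c.re • U - c.im • V, A.sub_mem (A.smul_mem _ hU) (A.smul_mem _ hV),
    c.im • U + c.re • V, A.add_mem (A.smul_mem _ hU) (A.smul_mem _ hV), ?_, ?_⟩
  · simp only [hreal]
    linear_combination (norm := module)
      hc • (U + Complex.I • V) + (c.im * Complex.I_mul_I) • V
  · simp only [hreal]
    linear_combination (norm := module)
      hconj • (U - Complex.I • V) + (c.im * Complex.I_mul_I) • V

end IsConjPair

end ConjPair

section StructureConstants

theorem linearIndependent_triple_iff {R V : Type*} [Ring R] [AddCommGroup V] [Module R V]
    {u v w : V} : LinearIndependent R ![u, v, w] ↔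
      ∀ a b c : R, a • u + b • v + c • w = 0 → a = 0 ∧ b = 0 ∧ c = 0 := by
  rw [Fintype.linearIndependent_iff]
  constructor
  · intro h a b c habc
    have hzero := h ![a, b, c] (by simpa [Fin.sum_univ_three] using habc)
    exact ⟨hzero 0, hzero 1, hzero 2⟩
  · intro h g hg
    rw [Fin.sum_univ_three] at hg
    obtain ⟨h0, h1, h2⟩ := h _ _ _ hg
    intro i
    fin_cases i <;> assumption

variable {L : Type*} [LieRing L] [LieAlgebra ℂ L] {x x' R y y' n : L} {μ α a : ℂ}

/-- The bracket relations which simple transitivity forces on a null pair `x, x'` in an abelian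
ideal, a null pair `y, y'` with non-zero Levi bracket against it, and the part `R` of this Levi
bracket transverse to `x, x'`. Primed elements are conjugates, and `n` stands for the
component of `⁅y, y'⁆` in the complexified ideal. -/
structure NullRelations (x x' R y y' n : L) (μ α a : ℂ) : Prop where
  lie_x'_x : ⁅x', x⁆ = 0
  lie_R_x : ⁅R, x⁆ = 0
  lie_R_x' : ⁅R, x'⁆ = 0
  lie_y_x : ⁅y, x⁆ = μ • x
  lie_y'_x' : ⁅y', x'⁆ = conj μ • x'
  lie_y'_x : ⁅y', x⁆ = R - α • x
  lie_y_x' : ⁅y, x'⁆ = R - conj α • x'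
  lie_y_y' : ⁅y, y'⁆ = a • y - conj a • y' + n
  lie_n_x : ⁅n, x⁆ = 0
  lie_n_x' : ⁅n, x'⁆ = 0
  lie_n_R : ⁅n, R⁆ = 0

namespace NullRelations

theorem symm (h : NullRelations x x' R y y' n μ α a) :
    NullRelations x' x R y' y (-n) (conj μ) (conj α) (conj a) where
  lie_x'_x := by rw [← lie_skew, h.lie_x'_x, neg_zero]
  lie_R_x := h.lie_R_x'
  lie_R_x' := h.lie_R_x
  lie_y_x := h.lie_y'_x'
  lie_y'_x' := by rw [Complex.conj_conj, h.lie_y_x]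
  lie_y'_x := h.lie_y_x'
  lie_y_x' := by rw [Complex.conj_conj, h.lie_y'_x]
  lie_y_y' := by rw [← lie_skew, h.lie_y_y', Complex.conj_conj]; abel
  lie_n_x := by rw [neg_lie, h.lie_n_x', neg_zero]
  lie_n_x' := by rw [neg_lie, h.lie_n_x, neg_zero]
  lie_n_R := by rw [neg_lie, h.lie_n_R, neg_zero]

theorem lie_y_R (h : NullRelations x x' R y y' n μ α a) :
    ⁅y, R⁆ = (a * μ + conj a * α) • x + (μ - conj a) • R := by
  have hjacobi := lie_lie y y' x
  simp only [h.lie_y_x, h.lie_y'_x, h.lie_y_y', h.lie_n_x, add_lie, sub_lie, smul_lie, lie_sub,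
    lie_smul] at hjacobi
  linear_combination (norm := module) -hjacobi

theorem lie_y'_R (h : NullRelations x x' R y y' n μ α a) :
    ⁅y', R⁆ = conj (a * μ + conj a * α) • x' + (conj μ - a) • R := by
  simpa only [map_add, map_mul, Complex.conj_conj] using h.symm.lie_y_R

/-- The Jacobi identity for `y`, `y'`, `R`. -/
theorem structure_constants (h : NullRelations x x' R y y' n μ α a)
    (hli : LinearIndependent ℂ ![x, x', R]) {ν : ℂ} (hν : ν = a * μ + conj a * α) :
    ν * (conj μ + α - 2 * a) = 0 ∧ conj ν = ν := by
  have hjacobi := lie_lie y y' R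
  simp only [h.lie_y'_x, h.lie_y_x', h.lie_y_y', h.lie_y_R, h.lie_y'_R, h.lie_n_R, ← hν, add_lie,
    sub_lie, smul_lie, lie_add, lie_smul] at hjacobi
  have hcomb : (ν * (conj μ + α - 2 * a)) • x + (-(conj ν * (μ + conj α - 2 * conj a))) • x'
      + (conj ν - ν - (a * μ - conj a * conj μ)) • R = 0 := by
    linear_combination (norm := module) -hjacobi
  obtain ⟨hx, -, hR⟩ := linearIndependent_triple_iff.1 hli _ _ _ hcomb
  refine ⟨hx, ?_⟩
  rcases mul_eq_zero.1 hx with h0 | h0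
  · rw [h0, map_zero]
  · have hμ : conj μ = 2 * a - α := by linear_combination h0
    have hμ' : μ = 2 * conj a - conj α := by
      simpa [Complex.conj_ofNat] using congrArg conj hμ
    rw [hν] at hR ⊢
    simp only [map_add, map_mul, Complex.conj_conj] at hR ⊢
    rw [hμ, hμ'] at hR ⊢
    linear_combination (2 / 3 : ℂ) * hR

end NullRelations

end StructureConstants

theorem lieBracket_fun_sum_right {𝕜 E ι : Type*} [NontriviallyNormedField 𝕜]
    [NormedAddCommGroup E] [NormedSpace 𝕜 E] {s : Finset ι} {V : E → E} {W : ι → E → E} {x : E}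
    (hW : ∀ j ∈ s, DifferentiableAt 𝕜 (W j) x) :
    VectorField.lieBracket 𝕜 V (fun z => ∑ j ∈ s, W j z) x =
      ∑ j ∈ s, VectorField.lieBracket 𝕜 V (W j) x := by
  simp only [VectorField.lieBracket, fderiv_fun_sum hW, sum_apply, map_sum,
    Finset.sum_sub_distrib]

section Coframe

variable {𝕜 E ι : Type*} [NontriviallyNormedField 𝕜] [NormedAddCommGroup E] [NormedSpace 𝕜 E]
  [Fintype ι] [DecidableEq ι]

/-- `Λ` is an analytic coframe near `p` dual to the vector fields `F j`, which therefore form a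
frame near `p`. -/
structure IsDualCoframe (F : ι → E → E) (Λ : E → E →L[𝕜] (ι → 𝕜)) (p : E) : Prop where
  analyticAt : AnalyticAt 𝕜 Λ p
  apply_frame : ∀ᶠ q in 𝓝 p, ∀ j, Λ q (F j q) = Pi.single j 1
  sum_smul : ∀ᶠ q in 𝓝 p, ∀ v, ∑ j, Λ q v j • F j q = v

theorem exists_isDualCoframe [CompleteSpace 𝕜] [FiniteDimensional 𝕜 E] {F : ι → E → E} {p : E}
    (hF : ∀ j, AnalyticAt 𝕜 (F j) p) (hli : LinearIndependent 𝕜 fun j => F j p)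
    (hcard : Fintype.card ι = Module.finrank 𝕜 E) :
    ∃ Λ : E → E →L[𝕜] (ι → 𝕜), IsDualCoframe F Λ p := by
  have : CompleteSpace E := FiniteDimensional.complete 𝕜 E
  let L : E → ((ι → 𝕜) →L[𝕜] E) := fun q =>
    ∑ j, (ContinuousLinearMap.proj (R := 𝕜) (φ := fun _ : ι => 𝕜) j).smulRight (F j q)
  have hL (q : E) (v : ι → 𝕜) : L q v = ∑ j, v j • F j q := by
    simp only [L, sum_apply, ContinuousLinearMap.smulRight_apply, ContinuousLinearMap.proj_apply]
  have hLsmooth : ContDiffAt 𝕜 ⊤ L p :=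
    ContDiffAt.sum fun j _ => contDiffAt_const.smulRight (hF j).contDiffAt
  have hinj : Function.Injective (L p) := by
    rw [injective_iff_map_eq_zero]
    intro v hv
    rw [hL] at hv
    exact funext (Fintype.linearIndependent_iff.1 hli v hv)
  let e : (ι → 𝕜) ≃L[𝕜] E :=
    (LinearEquiv.ofInjectiveOfFinrankEq (L p).toLinearMap hinj
      (by rw [Module.finrank_fintype_fun_eq_card, hcard])).toContinuousLinearEquiv
  have he : (e : (ι → 𝕜) →L[𝕜] E) = L p := by ext1 v; rfl
  have hequiv : ∀ᶠ q in 𝓝 p, ∃ e' : (ι → 𝕜) ≃L[𝕜] E, (e' : (ι → 𝕜) →L[𝕜] E) = L q :=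
    hLsmooth.continuousAt.eventually (he ▸ e.nhds)
  refine ⟨fun q => (L q).inverse, ?_, ?_, ?_⟩
  · exact (ContDiffAt.comp p (he ▸ contDiffAt_map_inverse e) hLsmooth).analyticAt
  · filter_upwards [hequiv] with q ⟨e', he'⟩ j
    have hsingle : e' (Pi.single j 1) = F j q := by
      have := hL q (Pi.single j 1)
      rw [← he'] at this
      simpa [Pi.single_apply] using this
    rw [← he', ContinuousLinearMap.inverse_equiv, ← hsingle]
    exact e'.symm_apply_apply _
  · filter_upwards [hequiv] with q ⟨e', he'⟩ v
    rw [← hL, ← he', ContinuousLinearMap.inverse_equiv]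
    exact e'.apply_symm_apply v

theorem IsDualCoframe.analyticAt_apply [CompleteSpace 𝕜] {F : ι → E → E} [CompleteSpace E]
    {Λ : E → E →L[𝕜] (ι → 𝕜)} {p : E} (hΛ : IsDualCoframe F Λ p) {X : E → E}
    (hX : AnalyticAt 𝕜 X p) (j : ι) : AnalyticAt 𝕜 (fun q => Λ q (X q) j) p :=
  ContDiffAt.analyticAt
    (contDiffAt_pi.1 ((hΛ.analyticAt.contDiffAt (n := ⊤)).clm_apply hX.contDiffAt) j)

theorem IsDualCoframe.fderiv_apply [CompleteSpace 𝕜] [CompleteSpace E] {F : ι → E → E}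
    {Λ : E → E →L[𝕜] (ι → 𝕜)} {p : E} (hΛ : IsDualCoframe F Λ p)
    (hF : ∀ j, AnalyticAt 𝕜 (F j) p) {X : E → E} (hX : AnalyticAt 𝕜 X p) (Y : E → E) (i : ι) :
    ∀ᶠ q in 𝓝 p, fderiv 𝕜 (fun z => Λ z (X z) i) q (Y q) =
      Λ q (VectorField.lieBracket 𝕜 Y X q) i
        - ∑ j, Λ q (X q) j * Λ q (VectorField.lieBracket 𝕜 Y (F j) q) i := by
  have hFd : ∀ᶠ q in 𝓝 p, ∀ j, DifferentiableAt 𝕜 (F j) q :=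
    eventually_all.2 fun j => (hF j).eventually_analyticAt.mono fun _ h => h.differentiableAt
  have hcoord : ∀ᶠ q in 𝓝 p, ∀ j, DifferentiableAt 𝕜 (fun z => Λ z (X z) j) q :=
    eventually_all.2 fun j =>
      (hΛ.analyticAt_apply hX j).eventually_analyticAt.mono fun _ h => h.differentiableAt
  filter_upwards [hFd, hcoord, hΛ.apply_frame, hΛ.sum_smul.eventually_nhds]
    with q hFd hcoord hΛF hsum
  have hX : X =ᶠ[𝓝 q] fun z => ∑ j, Λ z (X z) j • F j z := hsum.mono fun z hz => (hz _).symm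
  have hbracket : VectorField.lieBracket 𝕜 Y X q =
      ∑ j, (fderiv 𝕜 (fun z => Λ z (X z) j) q (Y q) • F j q
        + Λ q (X q) j • VectorField.lieBracket 𝕜 Y (F j) q) := by
    rw [EventuallyEq.rfl.lieBracket_vectorField_eq hX,
      lieBracket_fun_sum_right fun j _ => (hcoord j).fun_smul (hFd j)]
    exact Finset.sum_congr rfl fun j _ => VectorField.lieBracket_smul_right (hcoord j) (hFd j)
  rw [hbracket]
  simp [Finset.sum_add_distrib, hΛF, Pi.single_apply]

end Coframe

section FrameUniqueness

theorem eq_zero_of_norm_fderiv_le_on_segment {E G : Type*} [NormedAddCommGroup E] [NormedSpace ℝ E]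
    [NormedAddCommGroup G] [NormedSpace ℝ G] {f : E → G} {a b : E} {K : ℝ}
    (hf : ∀ z ∈ segment ℝ a b, DifferentiableAt ℝ f z)
    (hb : ∀ z ∈ segment ℝ a b, ‖fderiv ℝ f z (b - a)‖ ≤ K * ‖f z‖) (ha : f a = 0) : f b = 0 := by
  have hmem (t : ℝ) (ht : t ∈ Set.Icc (0 : ℝ) 1) : a + t • (b - a) ∈ segment ℝ a b := by
    rw [segment_eq_image']
    exact ⟨t, ht, rfl⟩
  have hderiv (t : ℝ) (ht : t ∈ Set.Icc (0 : ℝ) 1) :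
      HasDerivAt (fun t : ℝ => f (a + t • (b - a))) (fderiv ℝ f (a + t • (b - a)) (b - a)) t := by
    have hline : HasDerivAt (fun t : ℝ => a + t • (b - a)) (b - a) t := by
      simpa using ((hasDerivAt_id t).smul_const (b - a)).const_add a
    exact (hf _ (hmem t ht)).hasFDerivAt.comp_hasDerivAt t hline
  have hgronwall := eq_zero_of_abs_deriv_le_mul_abs_self_of_eq_zero_right (K := K)
    (fun t ht => (hderiv t ht).continuousAt.continuousWithinAt)
    (fun t ht => (hderiv t (Set.Ico_subset_Icc_self ht)).hasDerivWithinAt)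
    (by simpa using ha) (fun t ht => hb _ (hmem t (Set.Ico_subset_Icc_self ht))) 1
    (by simp)
  simpa using hgronwall

theorem IsDualCoframe.eventually_eq_zero {𝕜 E G ι : Type*} [RCLike 𝕜] [NormedAddCommGroup E]
    [NormedSpace 𝕜 E] [NormedSpace ℝ E] [IsScalarTower ℝ 𝕜 E] [NormedAddCommGroup G]
    [NormedSpace 𝕜 G] [NormedSpace ℝ G] [IsScalarTower ℝ 𝕜 G] [CompleteSpace G] [Fintype ι]
    [DecidableEq ι] {F : ι → E → E} {Λ : E → E →L[𝕜] (ι → 𝕜)} {p : E}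
    (hΛ : IsDualCoframe F Λ p) {u : E → G} (hu : AnalyticAt 𝕜 u p) {c : ι → ℝ}
    (h : ∀ᶠ q in 𝓝 p, ∀ j, ‖fderiv 𝕜 u q (F j q)‖ ≤ c j * ‖u q‖) (h0 : u p = 0) :
    ∀ᶠ q in 𝓝 p, u q = 0 := by
  have hbound : ∀ᶠ q in 𝓝 p, ‖Λ q‖ < ‖Λ p‖ + 1 :=
    hΛ.analyticAt.continuousAt.norm.eventually_lt_const (lt_add_one _)
  obtain ⟨ε, hε, hball⟩ := Metric.eventually_nhds_iff_ball.1
    (h.and (hΛ.sum_smul.and (hbound.and hu.eventually_analyticAt)))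
  filter_upwards [Metric.ball_mem_nhds p hε] with q hq
  have hseg : segment ℝ p q ⊆ Metric.ball p ε :=
    (convex_ball p ε).segment_subset (Metric.mem_ball_self hε) hq
  refine eq_zero_of_norm_fderiv_le_on_segment (a := p)
    (K := ∑ j, (‖Λ p‖ + 1) * ‖q - p‖ * c j)
    (fun z hz => (hball z (hseg hz)).2.2.2.differentiableAt.restrictScalars ℝ)
    (fun z hz => ?_) h0
  obtain ⟨hfderiv, hsum, hΛz, huz⟩ := hball z (hseg hz)
  have hcoord (j : ι) : ‖Λ z (q - p) j‖ ≤ (‖Λ p‖ + 1) * ‖q - p‖ :=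
    (norm_le_pi_norm _ j).trans ((Λ z).le_of_opNorm_le hΛz.le _)
  calc ‖fderiv ℝ u z (q - p)‖ = ‖∑ j, Λ z (q - p) j • fderiv 𝕜 u z (F j z)‖ := by
        rw [huz.differentiableAt.fderiv_restrictScalars ℝ,
          ContinuousLinearMap.coe_restrictScalars']
        conv_lhs => rw [← hsum (q - p)]
        simp only [map_sum, map_smul]
    _ ≤ ∑ j, ‖Λ z (q - p) j‖ * ‖fderiv 𝕜 u z (F j z)‖ := by
        simp only [← norm_smul]
        exact norm_sum_le _ _
    _ ≤ ∑ j, (‖Λ p‖ + 1) * ‖q - p‖ * (c j * ‖u z‖) := by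
        gcongr with j
        exacts [hcoord j, hfderiv j]
    _ = _ := by simp only [Finset.sum_mul, mul_assoc]

end FrameUniqueness

section Coord

open HolVectorField

variable {p : Fin 3 → ℂ} {ι : Type*}

theorem HolVectorField.rep_sum (s : Finset ι) (g : ι → HolVectorField p) :
    rep (∑ j ∈ s, g j) =ᶠ[𝓝 p] fun q => ∑ j ∈ s, rep (g j) q := by
  classical
  induction s using Finset.induction_on with
  | empty => simpa only [Finset.sum_empty] using rep_zero
  | insert i s hi ih =>
    simp only [Finset.sum_insert hi]
    filter_upwards [rep_add (g i) (∑ j ∈ s, g j), ih] with q hadd hsum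
    rw [hadd, hsum]

/-- The `i`-th coordinate function, with respect to the coframe `Λ`, of a germ of a holomorphic
vector field. -/
noncomputable def HolVectorField.coord (Λ : (Fin 3 → ℂ) → (Fin 3 → ℂ) →L[ℂ] (ι → ℂ))
    (x : HolVectorField p) (i : ι) (q : Fin 3 → ℂ) : ℂ :=
  Λ q (rep x q) i

variable [Fintype ι] [DecidableEq ι] {f : ι → HolVectorField p}
  {Λ : (Fin 3 → ℂ) → (Fin 3 → ℂ) →L[ℂ] (ι → ℂ)} {x g : HolVectorField p}

theorem IsDualCoframe.analyticAt_coord (hΛ : IsDualCoframe (fun j => rep (f j)) Λ p)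
    (x : HolVectorField p) (i : ι) : AnalyticAt ℂ (coord Λ x i) p :=
  hΛ.analyticAt_apply (analyticAt_rep x) i

theorem IsDualCoframe.eventually_fderiv_coord (hΛ : IsDualCoframe (fun j => rep (f j)) Λ p)
    {l : ℂ} {β : ι → ℂ} {γ : Matrix ι ι ℂ} (hx : ⁅g, x⁆ = l • x + ∑ j, β j • f j)
    (hf : ∀ j, ⁅g, f j⁆ = ∑ i, γ j i • f i) (i : ι) :
    ∀ᶠ q in 𝓝 p, fderiv ℂ (coord Λ x i) q (rep g q) =
      l * coord Λ x i q + β i - ∑ j, γ j i * coord Λ x j q := by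
  have hsum (β : ι → ℂ) : ∀ᶠ q in 𝓝 p, Λ q (rep (∑ j, β j • f j) q) = β := by
    filter_upwards [rep_sum Finset.univ fun j => β j • f j,
      eventually_all.2 fun j => rep_smul (β j) (f j), hΛ.apply_frame] with q hsum hsmul hΛq
    simp only [hsum, hsmul, map_sum, map_smul, hΛq]
    exact (pi_eq_sum_univ' β).symm
  filter_upwards [hΛ.fderiv_apply (fun j => analyticAt_rep (f j)) (analyticAt_rep x) (rep g) i,
    rep_lie g x, eventually_all.2 fun j => rep_lie g (f j), rep_add (l • x) (∑ j, β j • f j),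
    rep_smul l x, hsum β, eventually_all.2 fun j => hsum (γ j)]
    with q hfderiv hgx hgf hadd hsmul hβ hγ
  change fderiv ℂ (fun z => Λ z (rep x z) i) q (rep g q) = _
  rw [hfderiv, ← hgx, hx, hadd, hsmul, map_add, hβ, map_smul]
  simp only [← hgf, hf, hγ, coord, Pi.add_apply, Pi.smul_apply, smul_eq_mul, mul_comm]

end Coord

namespace NullRelations

open HolVectorField

variable {p : Fin 3 → ℂ} {x x' R y y' n : HolVectorField p} {μ α a ν : ℂ}
  {Λ : (Fin 3 → ℂ) → (Fin 3 → ℂ) →L[ℂ] (Fin 3 → ℂ)}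

theorem eventually_fderiv_coord_x' (h : NullRelations x x' R y y' n μ α a)
    (hΛ : IsDualCoframe (fun j => rep (![x', R, y'] j)) Λ p) :
    ∀ᶠ q in 𝓝 p, fderiv ℂ (coord Λ x 0) q (rep x' q) = conj μ * coord Λ x 2 q ∧
      fderiv ℂ (coord Λ x 1) q (rep x' q) = 0 ∧ fderiv ℂ (coord Λ x 2) q (rep x' q) = 0 := by
  have hx'R : ⁅x', R⁆ = 0 := by rw [← lie_skew, h.lie_R_x', neg_zero]
  have hx'y' : ⁅x', y'⁆ = (-conj μ) • x' := by rw [← lie_skew, h.lie_y'_x', neg_smul]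
  have hder := hΛ.eventually_fderiv_coord (g := x') (x := x) (l := 0) (β := 0)
    (γ := !![0, 0, 0; 0, 0, 0; -conj μ, 0, 0]) (by simp [h.lie_x'_x])
    (by intro j; fin_cases j <;> simp [Fin.sum_univ_three, hx'R, hx'y'])
  filter_upwards [hder 0, hder 1, hder 2] with q h0 h1 h2
  simp [h0, h1, h2, Fin.sum_univ_three]

theorem eventually_fderiv_coord_R (h : NullRelations x x' R y y' n μ α a)
    (hν : ν = a * μ + conj a * α) (hνr : conj ν = ν)
    (hΛ : IsDualCoframe (fun j => rep (![x', R, y'] j)) Λ p) :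
    ∀ᶠ q in 𝓝 p, fderiv ℂ (coord Λ x 0) q (rep R q) = ν * coord Λ x 2 q ∧
      fderiv ℂ (coord Λ x 1) q (rep R q) = (conj μ - a) * coord Λ x 2 q ∧
      fderiv ℂ (coord Λ x 2) q (rep R q) = 0 := by
  have hRy' : ⁅R, y'⁆ = (-ν) • x' + (a - conj μ) • R := by
    rw [← lie_skew, h.lie_y'_R, ← hν, hνr]
    module
  have hder := hΛ.eventually_fderiv_coord (g := R) (x := x) (l := 0) (β := 0)
    (γ := !![0, 0, 0; 0, 0, 0; -ν, a - conj μ, 0]) (by simp [h.lie_R_x])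
    (by intro j; fin_cases j <;> simp [Fin.sum_univ_three, h.lie_R_x', hRy'])
  filter_upwards [hder 0, hder 1, hder 2] with q h0 h1 h2
  simp only [h0, h1, h2, Fin.sum_univ_three]
  refine ⟨?_, ?_, ?_⟩ <;> simp
  ring

theorem eventually_fderiv_coord_y' (h : NullRelations x x' R y y' n μ α a)
    (hν : ν = a * μ + conj a * α) (hνr : conj ν = ν)
    (hΛ : IsDualCoframe (fun j => rep (![x', R, y'] j)) Λ p) :
    ∀ᶠ q in 𝓝 p,
      fderiv ℂ (coord Λ x 0) q (rep y' q)
        = -(α + conj μ) * coord Λ x 0 q - ν * coord Λ x 1 q ∧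
      fderiv ℂ (coord Λ x 1) q (rep y' q) = 1 - (α + conj μ - a) * coord Λ x 1 q ∧
      fderiv ℂ (coord Λ x 2) q (rep y' q) = -α * coord Λ x 2 q := by
  have hy'R : ⁅y', R⁆ = ν • x' + (conj μ - a) • R := by rw [h.lie_y'_R, ← hν, hνr]
  have hder := hΛ.eventually_fderiv_coord (g := y') (x := x) (l := -α) (β := ![0, 1, 0])
    (γ := !![conj μ, 0, 0; ν, conj μ - a, 0; 0, 0, 0])
    (by
      rw [h.lie_y'_x]
      simp only [Fin.sum_univ_three, Matrix.cons_val]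
      module)
    (by intro j; fin_cases j <;> simp [Fin.sum_univ_three, h.lie_y'_x', hy'R])
  filter_upwards [hder 0, hder 1, hder 2] with q h0 h1 h2
  simp only [h0, h1, h2, Fin.sum_univ_three]
  refine ⟨?_, ?_, ?_⟩ <;> simp <;> ring

theorem eventually_coord_two_eq_zero (h : NullRelations x x' R y y' n μ α a)
    (hν : ν = a * μ + conj a * α) (hνr : conj ν = ν)
    (hΛ : IsDualCoframe (fun j => rep (![x', R, y'] j)) Λ p) (hx : eval x = 0) :
    ∀ᶠ q in 𝓝 p, coord Λ x 2 q = 0 := by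
  refine hΛ.eventually_eq_zero (hΛ.analyticAt_coord x 2) (c := ![0, 0, ‖α‖]) ?_
    (by rw [coord, rep_self, hx, map_zero]; rfl)
  filter_upwards [h.eventually_fderiv_coord_x' hΛ, h.eventually_fderiv_coord_R hν hνr hΛ,
    h.eventually_fderiv_coord_y' hν hνr hΛ] with q ⟨_, _, hx'⟩ ⟨_, _, hR⟩ ⟨_, _, hy'⟩ j
  fin_cases j <;> simp [hx', hR, hy']

theorem eventually_coord_zero_eq (h : NullRelations x x' R y y' n μ α a)
    (hν : ν = a * μ + conj a * α) (hνr : conj ν = ν) (hν0 : ν * (conj μ + α - 2 * a) = 0)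
    (hΛ : IsDualCoframe (fun j => rep (![x', R, y'] j)) Λ p) (hx : eval x = 0) :
    ∀ᶠ q in 𝓝 p, coord Λ x 0 q + ν / 2 * coord Λ x 1 q ^ 2 = 0 := by
  have hcoord (j : Fin 3) : coord Λ x j p = 0 := by rw [coord, rep_self, hx, map_zero]; rfl
  have han := hΛ.analyticAt_coord x
  refine hΛ.eventually_eq_zero ((han 0).add (analyticAt_const.mul ((han 1).pow 2)))
    (c := ![0, 0, ‖α + conj μ‖]) ?_ (by simp [hcoord])
  filter_upwards [h.eventually_fderiv_coord_x' hΛ, h.eventually_fderiv_coord_R hν hνr hΛ,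
    h.eventually_fderiv_coord_y' hν hνr hΛ, h.eventually_coord_two_eq_zero hν hνr hΛ hx,
    (han 0).eventually_analyticAt, (han 1).eventually_analyticAt]
    with q ⟨h0x', h1x', _⟩ ⟨h0R, h1R, _⟩ ⟨h0y', h1y', _⟩ h2 hd0 hd1
  have hd (v : Fin 3 → ℂ) :
      fderiv ℂ (fun q => coord Λ x 0 q + ν / 2 * coord Λ x 1 q ^ 2) q v =
        fderiv ℂ (coord Λ x 0) q v + ν * coord Λ x 1 q * fderiv ℂ (coord Λ x 1) q v := by
    rw [(hd0.differentiableAt.hasFDerivAt.fun_add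
      ((hd1.differentiableAt.hasFDerivAt.pow 2).const_mul (ν / 2))).fderiv]
    simp
    ring
  have hy' : -(α + conj μ) * coord Λ x 0 q - ν * coord Λ x 1 q
      + ν * coord Λ x 1 q * (1 - (α + conj μ - a) * coord Λ x 1 q)
      = -(α + conj μ) * (coord Λ x 0 q + ν / 2 * coord Λ x 1 q ^ 2) := by
    linear_combination (-(1 / 2) * coord Λ x 1 q ^ 2) * hν0
  intro j
  rw [hd]
  fin_cases j
  · simp [h0x', h1x', h2]
  · simp [h0R, h1R, h2]
  · simp only [Fin.reduceFinMk, Matrix.cons_val, h0y', h1y', hy', norm_mul, norm_neg, le_refl]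

theorem ne_zero (h : NullRelations x x' R y y' n μ α a) (hR : eval R ≠ 0) : x ≠ 0 := by
  rintro rfl
  have hR0 : R = 0 := by simpa using h.lie_y'_x.symm
  exact hR (by rw [hR0, map_zero])

theorem linearIndependent (h : NullRelations x x' R y y' n μ α a) (hx : eval x = 0)
    (hli : LinearIndependent ℂ ![eval x', eval R, eval y']) :
    LinearIndependent ℂ ![x, x', R] := by
  rw [linearIndependent_triple_iff] at hli ⊢
  intro b c d hsum
  have heval := congrArg eval hsum
  simp only [map_add, map_smul, hx, smul_zero, zero_add, map_zero] at heval
  obtain ⟨rfl, rfl, -⟩ := hli c d 0 (by rw [heval, zero_smul, add_zero])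
  have hR : eval R ≠ 0 := fun hR0 => one_ne_zero (hli 0 1 0 (by simp [hR0])).2.1
  rw [zero_smul, zero_smul, add_zero, add_zero] at hsum
  exact ⟨(smul_eq_zero.1 hsum).resolve_right (h.ne_zero hR), rfl, rfl⟩

theorem exists_rep_eq (h : NullRelations x x' R y y' n μ α a) (hx : eval x = 0)
    (hli : LinearIndependent ℂ ![eval x', eval R, eval y']) :
    ∃ (b : ℝ) (c : (Fin 3 → ℂ) → ℂ), AnalyticAt ℂ c p ∧ c p = 0 ∧
      ∀ᶠ q in 𝓝 p, rep x q = c q • rep R q - ((b : ℂ) * c q ^ 2) • rep x' q := by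
  obtain ⟨ν, hν⟩ : ∃ ν, ν = a * μ + conj a * α := ⟨_, rfl⟩
  obtain ⟨hν0, hνr⟩ := h.structure_constants (h.linearIndependent hx hli) hν
  have hframe : (fun j => rep (![x', R, y'] j) p) = ![eval x', eval R, eval y'] := by
    ext j : 1
    rw [rep_self]
    fin_cases j <;> rfl
  obtain ⟨Λ, hΛ⟩ := exists_isDualCoframe (𝕜 := ℂ) (F := fun j => rep (![x', R, y'] j)) (p := p)
    (fun j => analyticAt_rep _) (by rwa [hframe]) (by simp)
  have hb : ((ν.re / 2 : ℝ) : ℂ) = ν / 2 := by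
    rw [Complex.ofReal_div, Complex.conj_eq_iff_re.1 hνr, Complex.ofReal_ofNat]
  refine ⟨ν.re / 2, coord Λ x 1, hΛ.analyticAt_coord x 1, ?_, ?_⟩
  · rw [coord, rep_self, hx, map_zero]
    rfl
  · filter_upwards [h.eventually_coord_two_eq_zero hν hνr hΛ hx,
      h.eventually_coord_zero_eq hν hνr hν0 hΛ hx, hΛ.sum_smul] with q h2 h0 hsum
    have hxq := hsum (rep x q)
    rw [Fin.sum_univ_three] at hxq
    change coord Λ x 0 q • rep x' q + coord Λ x 1 q • rep R q + coord Λ x 2 q • rep y' q = _ at hxq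
    rw [h2] at hxq
    rw [hb]
    linear_combination (norm := module) -hxq + h0 • rep x' q

end NullRelations

/-- `A` is an abelian ideal of the Lie subalgebra `𝔤`. -/
structure IsAbelianIdealOf {K L : Type*} [CommRing K] [LieRing L] [LieAlgebra K L]
    (A : Submodule K L) (𝔤 : LieSubalgebra K L) : Prop where
  le : A ≤ 𝔤.toSubmodule
  lie_mem : ∀ g ∈ 𝔤, ∀ h ∈ A, ⁅g, h⁆ ∈ A
  lie_eq_zero : ∀ g ∈ A, ∀ h ∈ A, ⁅g, h⁆ = 0

theorem IsAbelianIdealOf.lie_eq_zero_of_isConjPair {L : Type*} [LieRing L] [LieAlgebra ℝ L]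
    [LieAlgebra ℂ L] {𝔤 : LieSubalgebra ℝ L} {A : Submodule ℝ L} {x x' z z' : L}
    (hA : IsAbelianIdealOf A 𝔤) (hx : IsConjPair A x x') (hz : IsConjPair A z z') :
    ⁅x, z⁆ = 0 := by
  obtain ⟨U, hU, V, hV, rfl, -⟩ := hx
  obtain ⟨W, hW, W', hW', rfl, -⟩ := hz
  simp only [add_lie, lie_add, smul_lie, lie_smul, hA.lie_eq_zero _ hU _ hW,
    hA.lie_eq_zero _ hU _ hW', hA.lie_eq_zero _ hV _ hW, hA.lie_eq_zero _ hV _ hW', smul_zero,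
    add_zero]

section NullPairs

open HolVectorField

variable {M : Set (Fin 3 → ℂ)} {p : Fin 3 → ℂ} {r : (Fin 3 → ℂ) → ℝ}
  {A : Submodule ℝ (HolVectorField p)} {x x' y y' z z' R g : HolVectorField p}

theorem re_holDifferential_eval_eq_zero (hr : IsLocalDefiningFunction M p r) (hp : p ∈ M)
    (hg : g ∈ hol M p) : (holDifferential r p (eval g)).re = 0 := by
  rw [re_holDifferential, fderiv_eval_eq_zero hr hp hg]

namespace IsConjPair

theorem eventually_holDifferential_rep (hr : IsLocalDefiningFunction M p r)
    (h : IsConjPair (hol M p).toSubmodule x x') : ∀ᶠ q in 𝓝 p, q ∈ M →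
      holDifferential r q (rep x' q) = -conj (holDifferential r q (rep x q)) := by
  obtain ⟨U, hU, V, hV, rfl, rfl⟩ := h
  filter_upwards [rep_add U (Complex.I • V), rep_sub U (Complex.I • V), rep_smul Complex.I V,
    eventually_fderiv_rep_eq_zero hr hU, eventually_fderiv_rep_eq_zero hr hV]
    with q hadd hsub hsmul hUq hVq hq
  rw [hadd, hsub, hsmul, map_add, map_sub, map_smul]
  apply Complex.ext <;> simp [re_holDifferential, hUq hq, hVq hq]

theorem holDifferential_eval (hr : IsLocalDefiningFunction M p r) (hp : p ∈ M)
    (h : IsConjPair (hol M p).toSubmodule x x') :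
    holDifferential r p (eval x') = -conj (holDifferential r p (eval x)) := by
  rw [← rep_self, ← rep_self]
  exact (h.eventually_holDifferential_rep hr).self_of_nhds hp

theorem holDifferential_eval_right_eq_zero (hr : IsLocalDefiningFunction M p r) (hp : p ∈ M)
    (h : IsConjPair (hol M p).toSubmodule x x') (hx : holDifferential r p (eval x) = 0) :
    holDifferential r p (eval x') = 0 := by
  rw [h.holDifferential_eval hr hp, hx, map_zero, neg_zero]

theorem eq_zero_of_eval_eq_zero (hst : IsHolSimplyTransitiveAt M p)
    (hr : IsLocalDefiningFunction M p r) (hp : p ∈ M) (h : IsConjPair (hol M p).toSubmodule x x')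
    (hx : eval x = 0) (hx' : eval x' = 0) : x = 0 := by
  obtain ⟨U, hU, V, hV, rfl, rfl⟩ := h
  rw [map_add, map_smul] at hx
  rw [map_sub, map_smul] at hx'
  have hU0 : eval U = 0 := by linear_combination (norm := module) (1 / 2 : ℂ) • (hx + hx')
  have hV0 : eval V = 0 := by
    rw [hU0, zero_add] at hx
    exact (smul_eq_zero.1 hx).resolve_left Complex.I_ne_zero
  rw [hst.eq_zero_of_eval_eq_zero hr hp hU hU0, hst.eq_zero_of_eval_eq_zero hr hp hV hV0,
    smul_zero, add_zero]

theorem eq_of_eval_eq (hst : IsHolSimplyTransitiveAt M p)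
    (hr : IsLocalDefiningFunction M p r) (hp : p ∈ M) (hx : IsConjPair (hol M p).toSubmodule x x')
    (hz : IsConjPair (hol M p).toSubmodule z z') (h : eval z = eval x) (h' : eval z' = eval x') :
    z = x :=
  sub_eq_zero.1 <| (hz.sub hx).eq_zero_of_eval_eq_zero hst hr hp
    (by rw [map_sub, h, sub_self]) (by rw [map_sub, h', sub_self])

end IsConjPair

theorem exists_isConjPair_of_holDifferential_eq_zero (hst : IsHolSimplyTransitiveAt M p)
    (hr : IsLocalDefiningFunction M p r) (hp : p ∈ M) {w : Fin 3 → ℂ}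
    (hw : holDifferential r p w = 0) :
    ∃ y y', IsConjPair (hol M p).toSubmodule y y' ∧ eval y = 0 ∧ eval y' = w := by
  have htangent (c : ℂ) : ∃ W ∈ hol M p, eval W = c • w :=
    hst.exists_eval_eq hr hp <| by
      rw [← re_holDifferential, map_smul, hw, smul_zero, Complex.zero_re]
  obtain ⟨W, hW, hWe⟩ := htangent (1 / 2)
  obtain ⟨W', hW', hWe'⟩ := htangent (Complex.I / 2)
  refine ⟨_, _, ⟨W, hW, W', hW', rfl, rfl⟩, ?_, ?_⟩
  · rw [map_add, map_smul, hWe, hWe']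
    linear_combination (norm := module) (Complex.I_mul_I / 2) • w
  · rw [map_sub, map_smul, hWe, hWe']
    linear_combination (norm := module) (-Complex.I_mul_I / 2) • w

theorem exists_isConjPair_holDifferential_lie_ne_zero (hst : IsHolSimplyTransitiveAt M p)
    (hr : IsLocalDefiningFunction M p r) (hp : p ∈ M)
    (hL : ∀ v ≠ 0, holDifferential r p v = 0 →
      ∃ w, holDifferential r p w = 0 ∧ leviForm r p v w ≠ 0)
    (hx : IsConjPair (hol M p).toSubmodule x x') (hx0 : eval x = 0) (hx'0 : eval x' ≠ 0) :
    ∃ y y', IsConjPair (hol M p).toSubmodule y y' ∧ eval y = 0 ∧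
      holDifferential r p (eval ⁅y', x⁆) ≠ 0 := by
  have hdx' := hx.holDifferential_eval_right_eq_zero hr hp (by rw [hx0, map_zero])
  obtain ⟨U, hU, V, hV, rfl, rfl⟩ := hx
  rw [map_add, map_smul] at hx0
  have hUV : eval V = Complex.I • eval U := by
    linear_combination (norm := module) -Complex.I • hx0 + Complex.I_mul_I • eval V
  have hUx' : eval (U - Complex.I • V) = (2 : ℂ) • eval U := by
    rw [map_sub, map_smul, two_smul]
    linear_combination (norm := module) -hx0
  rw [hUx'] at hx'0 hdx'
  obtain ⟨w, hw, hUw⟩ := hL (eval U) (right_ne_zero_of_smul hx'0) (by simpa using hdx')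
  obtain ⟨y, y', hy, hy0, rfl⟩ := exists_isConjPair_of_holDifferential_eq_zero hst hr hp hw
  refine ⟨y, y', hy, hy0, fun h => hUw ?_⟩
  rw [← neg_eq_zero, ← fderiv_eval_lie_eq_neg_leviForm hr hp hU hV hUV hw, ← re_holDifferential, h,
    Complex.zero_re]

/-- A null pair `x, x'` in the complexification of `A` and a null pair `y, y'` of symmetries, whose
Levi bracket is normalised. By this normalisation `⁅y', x⁆` is, modulo complex tangent
directions, a real element of `A`. -/
structure IsLeviAdapted (M : Set (Fin 3 → ℂ)) (r : (Fin 3 → ℂ) → ℝ)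
    (A : Submodule ℝ (HolVectorField p)) (x x' y y' : HolVectorField p) : Prop where
  isConjPair_x : IsConjPair A x x'
  isConjPair_y : IsConjPair (hol M p).toSubmodule y y'
  eval_x : eval x = 0
  eval_y : eval y = 0
  holDifferential_lie : holDifferential r p (eval ⁅y', x⁆) = Complex.I

theorem exists_isLeviAdapted (hst : IsHolSimplyTransitiveAt M p)
    (hr : IsLocalDefiningFunction M p r) (hp : p ∈ M)
    (hL : ∀ v ≠ 0, holDifferential r p v = 0 →
      ∃ w, holDifferential r p w = 0 ∧ leviForm r p v w ≠ 0)
    (hA : A ≤ (hol M p).toSubmodule)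
    (hx : IsConjPair A x x') (hx0 : eval x = 0) (hx'0 : eval x' ≠ 0) :
    ∃ x x' y y', IsLeviAdapted M r A x x' y y' := by
  obtain ⟨y, y', hy, hy0, hne⟩ :=
    exists_isConjPair_holDifferential_lie_ne_zero hst hr hp hL (hx.mono hA) hx0 hx'0
  refine ⟨_, _, y, y', hx.smul (Complex.I / holDifferential r p (eval ⁅y', x⁆)), hy,
    by rw [map_smul, hx0, smul_zero], hy0, ?_⟩
  rw [lie_smul, map_smul, map_smul, smul_eq_mul, div_mul_cancel₀ _ hne]

namespace IsLeviAdapted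

variable (hst : IsHolSimplyTransitiveAt M p) (hr : IsLocalDefiningFunction M p r) (hp : p ∈ M)
  (hA : IsAbelianIdealOf A (hol M p)) (h : IsLeviAdapted M r A x x' y y')
include hst hr hp hA h

omit hst hA in
theorem holDifferential_x' (hle : A ≤ (hol M p).toSubmodule) :
    holDifferential r p (eval x') = 0 :=
  (h.isConjPair_x.mono hle).holDifferential_eval_right_eq_zero hr hp (by rw [h.eval_x, map_zero])

omit hst hA in
theorem holDifferential_y' : holDifferential r p (eval y') = 0 :=
  h.isConjPair_y.holDifferential_eval_right_eq_zero hr hp (by rw [h.eval_y, map_zero])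

theorem linearIndependent (hR : holDifferential r p (eval R) = Complex.I) :
    LinearIndependent ℂ ![eval x', eval R, eval y'] := by
  have hx := h.isConjPair_x.mono hA.le
  have hlie := h.holDifferential_lie
  have hx'0 : eval x' ≠ 0 := fun h0 => by
    rw [hx.eq_zero_of_eval_eq_zero hst hr hp h.eval_x h0, lie_zero, map_zero, map_zero] at hlie
    exact Complex.I_ne_zero hlie.symm
  have hxy (k : ℂ) : eval y' ≠ k • eval x' := fun hk => by
    have : y' = k • x' := (hx.symm.smul k).eq_of_eval_eq hst hr hp h.isConjPair_y.symm
      (by rw [hk, map_smul]) (by rw [map_smul, h.eval_x, h.eval_y, smul_zero])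
    rw [this, smul_lie, hA.lie_eq_zero_of_isConjPair h.isConjPair_x.symm h.isConjPair_x] at hlie
    simp only [smul_zero, map_zero] at hlie
    exact Complex.I_ne_zero hlie.symm
  rw [linearIndependent_triple_iff]
  intro a b c habc
  have hb : b = 0 := by
    have := congrArg (holDifferential r p) habc
    simpa [hR, h.holDifferential_x' hr hp hA.le, h.holDifferential_y' hr hp] using this
  have hc : c = 0 := by
    by_contra hc
    refine hxy (-c⁻¹ * a) (smul_right_injective _ hc ?_)
    simp only [smul_smul, ← mul_assoc, mul_neg, mul_inv_cancel₀ hc]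
    linear_combination (norm := module) habc - hb • eval R
  rw [hb, hc] at habc
  exact ⟨(smul_eq_zero.1 (by simpa using habc)).resolve_right hx'0, hb, hc⟩

theorem exists_eq_combination (hRA : R ∈ hol M p) (hR : holDifferential r p (eval R) = Complex.I)
    (hg : g ∈ hol M p) : ∃ (a b : ℂ) (t : ℝ), holDifferential r p (eval g) = t * Complex.I ∧
      g = conj a • x + a • x' + (t : ℂ) • R + (conj b • y + b • y') := by
  have hx := h.isConjPair_x.mono hA.le
  have hli := h.linearIndependent hst hr hp hA hR
  obtain ⟨k, hk⟩ := (Submodule.mem_span_range_iff_exists_fun ℂ).1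
    ((hli.span_eq_top_of_card_eq_finrank (by simp)).ge (Submodule.mem_top (x := eval g)))
  simp only [Fin.sum_univ_three, Matrix.cons_val] at hk
  have hdg : holDifferential r p (eval g) = k 1 * Complex.I := by
    simp [← hk, hR, h.holDifferential_x' hr hp hA.le, h.holDifferential_y' hr hp]
  have hreal : k 1 = (k 1).re := by
    have := re_holDifferential_eval_eq_zero hr hp hg
    rw [hdg] at this
    exact Complex.ext rfl (by simpa using this)
  have hpair := (((hx.smul (conj (k 0))).add (hx.smul (conj (k 0))).symm).add
    ((IsConjPair.of_mem hRA).smul ((k 1).re : ℂ))).add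
    ((h.isConjPair_y.smul (conj (k 2))).add (h.isConjPair_y.smul (conj (k 2))).symm)
  simp only [Complex.conj_conj, Complex.conj_ofReal] at hpair
  refine ⟨k 0, k 2, (k 1).re, by rw [← hreal, hdg],
    hpair.eq_of_eval_eq hst hr hp (IsConjPair.of_mem hg) ?_ ?_⟩ <;>
  · simp only [map_add, map_smul, h.eval_x, h.eval_y, ← hk]
    rw [← hreal]
    module

theorem exists_eq_of_mem (hRA : R ∈ A) (hR : holDifferential r p (eval R) = Complex.I)
    (hg : g ∈ A) (hg0 : holDifferential r p (eval g) = 0) :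
    ∃ a : ℂ, g = conj a • x + a • x' := by
  obtain ⟨a, b, t, ht, hgt⟩ := h.exists_eq_combination hst hr hp hA (hA.le hRA) hR (hA.le hg)
  have ht0 : t = 0 := by simpa [hg0] using ht
  rw [ht0, Complex.ofReal_zero, zero_smul, add_zero] at hgt
  -- Only the `y'`-component of an element of `A` contributes to its bracket with `x`.
  have hb : b = 0 := by
    have hlie := hA.lie_eq_zero_of_isConjPair (IsConjPair.of_mem hg) h.isConjPair_x
    simp only [hgt, add_lie, smul_lie, lie_self, smul_zero, zero_add,
      hA.lie_eq_zero_of_isConjPair h.isConjPair_x.symm h.isConjPair_x] at hlie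
    have := congrArg (fun t => holDifferential r p (eval t)) hlie
    simpa [eval_lie_eq_zero h.eval_y h.eval_x, h.holDifferential_lie] using this
  exact ⟨a, by rw [hgt, hb, map_zero, zero_smul, zero_smul, add_zero, add_zero]⟩

theorem exists_eq_of_isConjPair (hRA : R ∈ A) (hR : holDifferential r p (eval R) = Complex.I)
    (hz : IsConjPair A z z') (hz0 : holDifferential r p (eval z) = 0) :
    ∃ c d : ℂ, z = c • x + d • x' ∧ z' = conj c • x' + conj d • x := by
  obtain ⟨P, hP, Q, hQ, rfl, rfl⟩ := hz
  have hPre := re_holDifferential_eval_eq_zero hr hp (hA.le hP)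
  have hQre := re_holDifferential_eval_eq_zero hr hp (hA.le hQ)
  rw [map_add, map_smul, map_add, map_smul, smul_eq_mul, Complex.ext_iff] at hz0
  simp only [Complex.add_re, Complex.add_im, Complex.mul_re, Complex.mul_im, Complex.I_re,
    Complex.I_im, hPre, hQre, Complex.zero_re, Complex.zero_im, zero_mul, one_mul, zero_add,
    zero_sub, mul_zero, add_zero, neg_eq_zero] at hz0
  obtain ⟨a, ha⟩ := h.exists_eq_of_mem hst hr hp hA hRA hR hP (Complex.ext hPre hz0.2)
  obtain ⟨b, hb⟩ := h.exists_eq_of_mem hst hr hp hA hRA hR hQ (Complex.ext hQre hz0.1)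
  refine ⟨conj a + Complex.I * conj b, a + Complex.I * b, ?_, ?_⟩ <;>
  · simp only [map_add, map_mul, Complex.conj_I, Complex.conj_conj, ha, hb]
    module

theorem exists_lie_y_x_eq (hRA : R ∈ A) (hR : holDifferential r p (eval R) = Complex.I) :
    ∃ μ : ℂ, ⁅y, x⁆ = μ • x ∧ ⁅y', x'⁆ = conj μ • x' := by
  have hx'0 : eval x' ≠ 0 := by
    simpa using (h.linearIndependent hst hr hp hA hR).ne_zero 0
  have hlie0 := eval_lie_eq_zero h.eval_y h.eval_x
  obtain ⟨μ, d, hμ, hμ'⟩ := h.exists_eq_of_isConjPair hst hr hp hA hRA hR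
    (h.isConjPair_y.lie hA.lie_mem h.isConjPair_x) (by rw [hlie0, map_zero])
  have hd : d = 0 := by
    rw [hμ, map_add, map_smul, map_smul, h.eval_x, smul_zero, zero_add] at hlie0
    exact (smul_eq_zero.1 hlie0).resolve_right hx'0
  exact ⟨μ, by rw [hμ, hd, zero_smul, add_zero], by rw [hμ', hd, map_zero, zero_smul, add_zero]⟩

theorem exists_lie_y'_x_eq : ∃ R ∈ A, ∃ α : ℂ, holDifferential r p (eval R) = Complex.I ∧
    ⁅y', x⁆ = R - α • x ∧ ⁅y, x'⁆ = R - conj α • x' := by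
  have hz : IsConjPair A ⁅y', x⁆ ⁅y, x'⁆ := h.isConjPair_y.symm.lie hA.lie_mem h.isConjPair_x
  have hdx := h.holDifferential_x' hr hp hA.le
  have hz' : holDifferential r p (eval ⁅y, x'⁆) = Complex.I := by
    rw [(hz.mono hA.le).holDifferential_eval hr hp, h.holDifferential_lie, Complex.conj_I, neg_neg]
  obtain ⟨R, hRA, hR⟩ : ∃ R ∈ A, holDifferential r p (eval R) = Complex.I := by
    have hsum := (hz.add hz.symm).smul (1 / 2)
    have hself : IsConjPair A ((1 / 2 : ℂ) • (⁅y', x⁆ + ⁅y, x'⁆))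
        ((1 / 2 : ℂ) • (⁅y', x⁆ + ⁅y, x'⁆)) := by
      simpa [Complex.conj_ofNat, add_comm ⁅y, x'⁆] using hsum
    refine ⟨_, hself.mem, ?_⟩
    rw [map_smul, map_add, map_smul, map_add, h.holDifferential_lie, hz', smul_eq_mul]
    ring
  obtain ⟨c, d, hc, hd⟩ := h.exists_eq_of_isConjPair hst hr hp hA hRA hR
    (hz.sub (IsConjPair.of_mem hRA)) (by rw [map_sub, map_sub, h.holDifferential_lie, hR, sub_self])
  have hself := (h.isConjPair_x.smul (conj d)).add (h.isConjPair_x.smul (conj d)).symm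
  rw [Complex.conj_conj, add_comm (d • x')] at hself
  refine ⟨R + (conj d • x + d • x'), A.add_mem hRA hself.mem, conj d - c, ?_, ?_, ?_⟩
  · simp [hR, hdx, h.eval_x]
  · linear_combination (norm := module) hc
  · rw [map_sub, Complex.conj_conj]
    linear_combination (norm := module) hd

theorem exists_lie_y_y'_eq (hRA : R ∈ A) (hR : holDifferential r p (eval R) = Complex.I) :
    ∃ a b t : ℂ, ⁅y, y'⁆ = a • y - conj a • y' + (conj b • x - b • x' + t • R) := by
  have hI : Complex.I • ⁅y, y'⁆ ∈ hol M p := by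
    have hpair := (h.isConjPair_y.lie (fun _ hg _ hg' => (hol M p).lie_mem hg hg')
      h.isConjPair_y.symm).smul Complex.I
    rw [← lie_skew y', Complex.conj_I, neg_smul, smul_neg, neg_neg] at hpair
    exact hpair.mem
  obtain ⟨b, a, t, -, ht⟩ := h.exists_eq_combination hst hr hp hA (hA.le hRA) hR hI
  refine ⟨-Complex.I * conj a, Complex.I * b, -Complex.I * t, ?_⟩
  simp only [map_mul, map_neg, Complex.conj_I, Complex.conj_conj]
  linear_combination (norm := module) -Complex.I • ht + Complex.I_mul_I • ⁅y, y'⁆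

theorem exists_nullRelations : ∃ R ∈ A, ∃ (n : HolVectorField p) (μ α a : ℂ),
    holDifferential r p (eval R) = Complex.I ∧ NullRelations x x' R y y' n μ α a := by
  obtain ⟨R, hRA, α, hR, hα, hα'⟩ := h.exists_lie_y'_x_eq hst hr hp hA
  obtain ⟨μ, hμ, hμ'⟩ := h.exists_lie_y_x_eq hst hr hp hA hRA hR
  obtain ⟨a, b, t, ha⟩ := h.exists_lie_y_y'_eq hst hr hp hA hRA hR
  have hx := h.isConjPair_x
  have hR' := IsConjPair.of_mem hRA
  have hcomm {u u' v v' : HolVectorField p} (hu : IsConjPair A u u') (hv : IsConjPair A v v') :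
      ⁅u, v⁆ = 0 := hA.lie_eq_zero_of_isConjPair hu hv
  exact ⟨R, hRA, _, μ, α, a, hR,
    { lie_x'_x := hcomm hx.symm hx
      lie_R_x := hcomm hR' hx
      lie_R_x' := hcomm hR' hx.symm
      lie_y_x := hμ
      lie_y'_x' := hμ'
      lie_y'_x := hα
      lie_y_x' := hα'
      lie_y_y' := ha
      lie_n_x := by simp [hcomm hx.symm hx, hcomm hR' hx]
      lie_n_x' := by simp [hcomm hx hx.symm, hcomm hR' hx.symm]
      lie_n_R := by simp [hcomm hx hR', hcomm hx.symm hR'] }⟩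

end IsLeviAdapted

theorem re_conj_mul_eq_zero {ρ ξ c : ℂ} {b : ℝ} (hρ : ρ.re = 0)
    (h : ξ = c * ρ + b * c ^ 2 * conj ξ) (hb : b * Complex.normSq c ≠ 1) :
    (conj c * ξ).re = 0 := by
  have hs : conj c * ξ =
      (Complex.normSq c : ℂ) * ρ + ((b * Complex.normSq c : ℝ) : ℂ) * conj (conj c * ξ) := by
    rw [map_mul, Complex.conj_conj, Complex.ofReal_mul, Complex.normSq_eq_conj_mul_self]
    linear_combination conj c * h
  have hre := congrArg Complex.re hs
  rw [Complex.add_re, Complex.re_ofReal_mul, Complex.re_ofReal_mul, Complex.conj_re, hρ, mul_zero,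
    zero_add] at hre
  exact (mul_eq_zero.1 (show (1 - b * Complex.normSq c) * (conj c * ξ).re = 0 by
    linear_combination hre)).resolve_left fun h0 => hb (by linarith)

theorem smul_conj_mem_hol (hr : IsLocalDefiningFunction M p r)
    (hx : IsConjPair (hol M p).toSubmodule x x') (hR : R ∈ hol M p) {b : ℝ}
    {c : (Fin 3 → ℂ) → ℂ} (hc : AnalyticAt ℂ c p) (hc0 : c p = 0)
    (h : ∀ᶠ q in 𝓝 p, rep x q = c q • rep R q - ((b : ℂ) * c q ^ 2) • rep x' q) :
    ofAnalytic _ (hc.smul (analyticAt_rep x')) ∈ hol M p := by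
  rw [mem_hol_iff hr (rep_ofAnalytic _)]
  have hbc : ∀ᶠ q in 𝓝 p, b * Complex.normSq (c q) < 1 := by
    have hcont : ContinuousAt (fun q => b * Complex.normSq (c q)) p :=
      continuousAt_const.mul (Complex.continuous_normSq.continuousAt.comp hc.continuousAt)
    exact hcont.eventually_lt_const (by simp [hc0])
  filter_upwards [h, hbc, eventually_fderiv_rep_eq_zero hr hR, hx.eventually_holDifferential_rep hr]
    with q hq hbq hRq hxq hqM
  have hdx := congrArg (holDifferential r q) hq
  rw [map_sub, map_smul, map_smul, smul_eq_mul, smul_eq_mul, hxq hqM] at hdx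
  have hre := re_conj_mul_eq_zero (ξ := holDifferential r q (rep x q)) (c := c q) (b := b)
    ((re_holDifferential _ _ _).trans (hRq hqM)) (by linear_combination hdx) hbq.ne
  rw [Pi.smul_apply', ← re_holDifferential, map_smul, hxq hqM, smul_eq_mul, mul_neg, Complex.neg_re,
    ← Complex.conj_re, map_mul, Complex.conj_conj, hre, neg_zero]

theorem eval_eq_zero_of_isConjPair (hst : IsHolSimplyTransitiveAt M p)
    (hr : IsLocalDefiningFunction M p r) (hp : p ∈ M)
    (hL : ∀ v ≠ 0, holDifferential r p v = 0 →
      ∃ w, holDifferential r p w = 0 ∧ leviForm r p v w ≠ 0)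
    (hA : IsAbelianIdealOf A (hol M p)) (hx : IsConjPair A x x') (hx0 : eval x = 0) :
    eval x' = 0 := by
  by_contra hx'0
  obtain ⟨x, x', y, y', h⟩ := exists_isLeviAdapted hst hr hp hL hA.le hx hx0 hx'0
  obtain ⟨R, hRA, n, μ, α, a, hR, hrel⟩ := h.exists_nullRelations hst hr hp hA
  have hli := h.linearIndependent hst hr hp hA hR
  obtain ⟨b, c, hc, hc0, hrep⟩ := hrel.exists_rep_eq h.eval_x hli
  have hcx' := hst.eq_zero_of_eval_eq_zero hr hp
    (smul_conj_mem_hol hr (h.isConjPair_x.mono hA.le) (hA.le hRA) hc hc0 hrep)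
    (by rw [← rep_self, (rep_ofAnalytic _).self_of_nhds, Pi.smul_apply', hc0, zero_smul])
  have hrep' := rep_ofAnalytic (hc.smul (analyticAt_rep x'))
  rw [hcx'] at hrep'
  refine hrel.ne_zero (by simpa using hli.ne_zero 1) (eq_of_rep_eventuallyEq ?_)
  filter_upwards [hrep', rep_zero (p := p), hrep,
    (analyticAt_rep x').continuousAt.eventually_ne (y := 0)
      (by simpa [rep_self] using hli.ne_zero 0)] with q hq' hq0 hq hx'q
  have hcq : c q = 0 := (smul_eq_zero.1 (hq'.symm.trans hq0)).resolve_right hx'q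
  rw [hq, hq0, hcq, zero_smul, zero_pow two_ne_zero, mul_zero, zero_smul, sub_zero]

end NullPairs

section TotallyReal

open HolVectorField

theorem linearIndependent_complex_of_real {ι L E : Type*} [Finite ι] [AddCommGroup L] [Module ℂ L]
    [Module ℝ L] [IsScalarTower ℝ ℂ L] [AddCommGroup E] [Module ℂ E] (T : L →ₗ[ℂ] E)
    {A : Submodule ℝ L} {f : ι → L} (hfA : ∀ j, f j ∈ A) (hf : LinearIndependent ℝ f)
    (hA : ∀ U ∈ A, ∀ V ∈ A, T (U + Complex.I • V) = 0 → U = 0) :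
    LinearIndependent ℂ fun j => T (f j) := by
  have := Fintype.ofFinite ι
  rw [Fintype.linearIndependent_iff] at hf ⊢
  intro c hc
  have hmem (a : ι → ℝ) : ∑ j, a j • f j ∈ A := A.sum_mem fun j _ => A.smul_mem _ (hfA j)
  set U := ∑ j, (c j).re • f j with hU
  set V := ∑ j, (c j).im • f j with hV
  have hUV : U + Complex.I • V = ∑ j, c j • f j := by
    simp only [hU, hV, Finset.smul_sum, ← Finset.sum_add_distrib,
      ← IsScalarTower.algebraMap_smul ℂ (_ : ℝ) (_ : L), Complex.coe_algebraMap, smul_smul,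
      ← add_smul]
    simp only [mul_comm Complex.I, Complex.re_add_im]
  have hT : T (U + Complex.I • V) = 0 := by rw [hUV, map_sum, ← hc]; simp only [map_smul]
  have hT' : T (V + Complex.I • -U) = 0 := by
    have : V + Complex.I • -U = -Complex.I • (U + Complex.I • V) := by
      rw [smul_add, smul_smul, neg_mul, Complex.I_mul_I, neg_neg, one_smul, smul_neg, neg_smul,
        add_comm]
    rw [this, map_smul, hT, smul_zero]
  exact fun j => Complex.ext (hf _ (hA U (hmem _) V (hmem _) hT) j)
    (hf _ (hA V (hmem _) (-U) (A.neg_mem (hmem _)) hT') j)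

theorem exists_isAbelianIdealOf {K L : Type*} [CommRing K] [LieRing L] [LieAlgebra K L]
    {𝔤 : LieSubalgebra K L} (𝔞 : LieIdeal K 𝔤) [IsLieAbelian 𝔞] :
    ∃ A, IsAbelianIdealOf A 𝔤 ∧ Module.finrank K A = Module.finrank K 𝔞 := by
  refine ⟨𝔞.toSubmodule.map 𝔤.toSubmodule.subtype, ⟨?_, ?_, ?_⟩,
    (Submodule.equivMapOfInjective _ Subtype.val_injective _).finrank_eq.symm⟩
  · rintro _ ⟨g, -, rfl⟩
    exact g.2
  · rintro g hg _ ⟨h, hh, rfl⟩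
    exact ⟨⁅(⟨g, hg⟩ : 𝔤), h⁆, lie_mem_right K _ 𝔞 _ _ hh, rfl⟩
  · rintro _ ⟨g, hg, rfl⟩ _ ⟨h, hh, rfl⟩
    exact congrArg (fun x : 𝔞 => (x.1 : L)) (trivial_lie_zero 𝔞 𝔞 (⟨g, hg⟩ : 𝔞) ⟨h, hh⟩)

theorem IsAbelianIdealOf.exists_lie_eq_sum {K L ι : Type*} [CommRing K] [LieRing L]
    [LieAlgebra K L] [Fintype ι] {A : Submodule K L} {𝔤 : LieSubalgebra K L}
    (hA : IsAbelianIdealOf A 𝔤) (b : Module.Basis ι K A) {g : L} (hg : g ∈ 𝔤) :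
    ∃ c : ι → ι → K, ∀ k, ⁅(b k).1, g⁆ = ∑ j, c k j • (b j).1 := by
  have hmem (k : ι) : ⁅(b k).1, g⁆ ∈ A := by
    rw [← lie_skew]
    exact A.neg_mem (hA.lie_mem g hg _ (b k).2)
  refine ⟨fun k => b.repr ⟨_, hmem k⟩, fun k => ?_⟩
  simpa only [Submodule.coe_sum, Submodule.coe_smul] using
    (congrArg Subtype.val (b.sum_repr ⟨_, hmem k⟩)).symm

variable {M : Set (Fin 3 → ℂ)} {p : Fin 3 → ℂ} {r : (Fin 3 → ℂ) → ℝ}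
  {A : Submodule ℝ (HolVectorField p)}

theorem IsAbelianIdealOf.linearIndependent_eval (hst : IsHolSimplyTransitiveAt M p)
    (hr : IsLocalDefiningFunction M p r) (hp : p ∈ M)
    (hL : ∀ v ≠ 0, holDifferential r p v = 0 →
      ∃ w, holDifferential r p w = 0 ∧ leviForm r p v w ≠ 0)
    (hA : IsAbelianIdealOf A (hol M p)) {ι : Type*} [Finite ι] {f : ι → HolVectorField p}
    (hfA : ∀ j, f j ∈ A) (hf : LinearIndependent ℝ f) :
    LinearIndependent ℂ fun j => eval (f j) := by
  refine linearIndependent_complex_of_real eval hfA hf fun U hU V hV hx0 => ?_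
  have hx'0 := eval_eq_zero_of_isConjPair hst hr hp hL hA ⟨U, hU, V, hV, rfl, rfl⟩ hx0
  have hU0 : eval U = 0 := by
    rw [map_add] at hx0
    rw [map_sub] at hx'0
    linear_combination (norm := module) (1 / 2 : ℂ) • (hx0 + hx'0)
  exact hst.eq_zero_of_eval_eq_zero hr hp (hA.le hU) hU0

end TotallyReal

section Primitive

variable {𝕜 E F G : Type*} [RCLike 𝕜] [NormedAddCommGroup E] [NormedSpace 𝕜 E]
  [NormedAddCommGroup F] [NormedSpace 𝕜 F] [NormedAddCommGroup G] [NormedSpace 𝕜 G]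

/-- The power series of `y ↦ ∫ t in 0..1, q.sum (t • y)`, the average of `q` along the segments
issued from the centre. -/
noncomputable def radialAverage (q : FormalMultilinearSeries 𝕜 E G) :
    FormalMultilinearSeries 𝕜 E G :=
  fun n => ((n + 1 : ℕ) : 𝕜)⁻¹ • q n

theorem radius_le_radius_radialAverage (q : FormalMultilinearSeries 𝕜 E G) :
    q.radius ≤ (radialAverage q).radius := by
  refine ENNReal.le_of_forall_nnreal_lt fun s hs => ?_
  obtain ⟨C, -, hC⟩ := q.norm_mul_pow_le_of_lt_radius hs
  refine (radialAverage q).le_radius_of_bound C fun n => le_trans ?_ (hC n)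
  gcongr
  calc ‖radialAverage q n‖ = ((n + 1 : ℕ) : ℝ)⁻¹ * ‖q n‖ := by
        rw [radialAverage, norm_smul, norm_inv, RCLike.norm_natCast]
    _ ≤ 1 * ‖q n‖ := by
        gcongr
        exact inv_le_one_of_one_le₀ (by exact_mod_cast Nat.le_add_left 1 n)
    _ = ‖q n‖ := one_mul _

theorem smul_mem_eball_of_mem_Icc {y : E} {R : ENNReal} (hy : y ∈ Metric.eball (0 : E) R) {t : ℝ}
    (ht : t ∈ Set.Icc (0 : ℝ) 1) : (t : 𝕜) • y ∈ Metric.eball (0 : E) R := by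
  rw [Metric.mem_eball, edist_zero_right] at hy ⊢
  refine lt_of_le_of_lt ?_ hy
  rw [← ofReal_norm, ← ofReal_norm, norm_smul, RCLike.norm_ofReal, abs_of_nonneg ht.1]
  exact ENNReal.ofReal_le_ofReal (mul_le_of_le_one_left (norm_nonneg _) ht.2)

theorem integral_sum_smul [NormedSpace ℝ G] [IsScalarTower ℝ 𝕜 G] [CompleteSpace G]
    (q : FormalMultilinearSeries 𝕜 E G) {y : E} (hy : y ∈ Metric.eball 0 q.radius) :
    ∫ t in (0 : ℝ)..1, q.sum ((t : 𝕜) • y) = (radialAverage q).sum y := by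
  have hint (n : ℕ) : ∫ t in (0 : ℝ)..1, t ^ n • q n (fun _ => y) =
      radialAverage q n fun _ => y := by
    rw [intervalIntegral.integral_smul_const, integral_pow, RCLike.real_smul_eq_coe_smul (K := 𝕜)]
    simp [radialAverage]
  have hsum : HasSum (fun n : ℕ => ∫ t in (0 : ℝ)..1, t ^ n • q n (fun _ => y))
      (∫ t in (0 : ℝ)..1, q.sum ((t : 𝕜) • y)) := by
    refine intervalIntegral.hasSum_integral_of_dominated_convergence
      (fun n _ => ‖q n fun _ => y‖) (fun n => Continuous.aestronglyMeasurable (by fun_prop))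
      (fun n => Eventually.of_forall fun t ht => ?_)
      (Eventually.of_forall fun t _ => q.summable_norm_apply hy) intervalIntegrable_const
      (Eventually.of_forall fun t ht => ?_) <;> rw [Set.uIoc_of_le zero_le_one] at ht
    · rw [norm_smul, norm_pow, Real.norm_of_nonneg ht.1.le]
      exact mul_le_of_le_one_left (norm_nonneg _) (pow_le_one₀ ht.1.le ht.2)
    · convert q.hasSum (smul_mem_eball_of_mem_Icc hy ⟨ht.1.le, ht.2⟩) using 2 with n
      rw [(q n).map_smul_univ (fun _ => (t : 𝕜)) fun _ => y, Finset.prod_const, Finset.card_univ,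
        Fintype.card_fin, ← RCLike.ofReal_pow, ← RCLike.real_smul_eq_coe_smul]
  simp only [hint] at hsum
  exact hsum.unique ((radialAverage q).hasSum
    (Metric.eball_subset_eball (radius_le_radius_radialAverage q) hy))

theorem sub_eq_integral_of_hasFDerivAt [NormedSpace ℝ F] [IsScalarTower ℝ 𝕜 F] [CompleteSpace F]
    {f : E → F} {f' : E → E →L[𝕜] F} {x y : E}
    (hf : ∀ t ∈ Set.Icc (0 : ℝ) 1, HasFDerivAt f (f' (x + (t : 𝕜) • y)) (x + (t : 𝕜) • y))
    (hf' : ContinuousOn (fun t : ℝ => f' (x + (t : 𝕜) • y)) (Set.Icc 0 1)) :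
    f (x + y) - f x = (∫ t in (0 : ℝ)..1, f' (x + (t : 𝕜) • y)) y := by
  rw [← Set.uIcc_of_le zero_le_one] at hf hf'
  have hderiv (t : ℝ) (ht : t ∈ Set.uIcc (0 : ℝ) 1) :
      HasDerivAt (fun t : ℝ => f (x + (t : 𝕜) • y)) (f' (x + (t : 𝕜) • y) y) t := by
    have hline : HasDerivAt (fun t : 𝕜 => x + t • y) y (t : 𝕜) := by
      simpa using ((hasDerivAt_id (t : 𝕜)).smul_const y).const_add x
    have hcoe : HasDerivAt (fun t : ℝ => (t : 𝕜)) 1 t := by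
      simpa using (RCLike.ofRealCLM (K := 𝕜)).hasDerivAt (x := t)
    simpa [Function.comp_def] using ((hf t ht).comp_hasDerivAt _ hline).scomp t hcoe
  rw [ContinuousLinearMap.intervalIntegral_apply hf'.intervalIntegrable,
    intervalIntegral.integral_eq_sub_of_hasDerivAt hderiv
      (hf'.clm_apply continuousOn_const).intervalIntegrable]
  simp

theorem analyticAt_of_hasFDerivAt [CompleteSpace F] {f : E → F} {f' : E → E →L[𝕜] F} {x : E}
    (hf' : AnalyticAt 𝕜 f' x) (hf : ∀ᶠ y in 𝓝 x, HasFDerivAt f (f' y) y) : AnalyticAt 𝕜 f x := by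
  let _ := NormedSpace.restrictScalars ℝ 𝕜 F
  obtain ⟨q, R, hq⟩ := hf'
  obtain ⟨ε, hε, hball⟩ := EMetric.mem_nhds_iff.1 hf
  have hQ := (radialAverage q).hasFPowerSeriesOnBall
    (hq.r_pos.trans_le (hq.r_le.trans (radius_le_radius_radialAverage q)))
  have hfx (y : E) (hy : y ∈ Metric.eball (0 : E) (min R ε)) :
      f (x + y) = f x + (radialAverage q).sum y y := by
    have hyR := Metric.eball_subset_eball (min_le_left R ε) hy
    have hyε := Metric.eball_subset_eball (min_le_right R ε) hy
    have hsum (t : ℝ) (ht : t ∈ Set.Icc (0 : ℝ) 1) :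
        f' (x + (t : 𝕜) • y) = q.sum ((t : 𝕜) • y) :=
      hq.sum (smul_mem_eball_of_mem_Icc hyR ht)
    have hcont : ContinuousOn (fun t : ℝ => f' (x + (t : 𝕜) • y)) (Set.Icc 0 1) := by
      refine hq.continuousOn.comp (by fun_prop) fun t ht => ?_
      simpa [Metric.mem_eball, edist_eq_enorm_sub] using smul_mem_eball_of_mem_Icc (𝕜 := 𝕜) hyR ht
    rw [← sub_eq_iff_eq_add', sub_eq_integral_of_hasFDerivAt (𝕜 := 𝕜) (fun t ht => hball ?_) hcont,
      ← integral_sum_smul q (Metric.eball_subset_eball hq.r_le hyR)]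
    · congr 1
      refine intervalIntegral.integral_congr fun t ht => hsum t ?_
      rwa [← Set.uIcc_of_le zero_le_one]
    · simpa [Metric.mem_eball, edist_eq_enorm_sub] using smul_mem_eball_of_mem_Icc (𝕜 := 𝕜) hyε ht
  have hQx : AnalyticAt 𝕜 (fun z => (radialAverage q).sum (z - x)) x := by
    simpa using (hQ.comp_sub x).analyticAt
  have han : AnalyticAt 𝕜 (fun z => f x + (radialAverage q).sum (z - x) (z - x)) x := by
    have happly : ContDiffAt 𝕜 ⊤ (fun z => (radialAverage q).sum (z - x) (z - x)) x :=
      hQx.contDiffAt.clm_apply (contDiffAt_id.sub contDiffAt_const)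
    exact analyticAt_const.add happly.analyticAt
  refine han.congr ?_
  filter_upwards [Metric.eball_mem_nhds x (lt_min hq.r_pos hε)] with z hz
  rw [← hfx (z - x) (by simpa [Metric.mem_eball, edist_eq_enorm_sub] using hz), add_sub_cancel]

end Primitive

section Rectification

variable {𝕜 E ι : Type*} [RCLike 𝕜] [NormedAddCommGroup E] [NormedSpace 𝕜 E] [Fintype ι]
  [DecidableEq ι]

theorem fderiv_symm_apply_fderiv {F : Type*} [NormedAddCommGroup F] [NormedSpace 𝕜 F]
    {Φ : OpenPartialHomeomorph E F} {q : E} (hq : q ∈ Φ.source) (hΦ : DifferentiableAt 𝕜 Φ q)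
    (hΦ' : DifferentiableAt 𝕜 Φ.symm (Φ q)) (v : E) :
    fderiv 𝕜 Φ.symm (Φ q) (fderiv 𝕜 Φ q v) = v := by
  have hid : HasFDerivAt (Φ.symm ∘ Φ) (ContinuousLinearMap.id 𝕜 E) q :=
    (hasFDerivAt_id q).congr_of_eventuallyEq (Φ.eventually_left_inverse hq)
  exact congrArg (fun l => l v) ((hΦ'.hasFDerivAt.comp q hΦ.hasFDerivAt).unique hid)

namespace IsDualCoframe

variable {F : ι → E → E} {Λ : E → E →L[𝕜] (ι → 𝕜)} {p : E}

theorem eventually_exists_equiv (hΛ : IsDualCoframe F Λ p) :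
    ∀ᶠ q in 𝓝 p, ∃ e : E ≃L[𝕜] (ι → 𝕜), (e : E →L[𝕜] (ι → 𝕜)) = Λ q := by
  filter_upwards [hΛ.apply_frame, hΛ.sum_smul] with q hframe hsum
  refine ⟨.equivOfInverse (Λ q)
    (∑ j, (ContinuousLinearMap.proj (R := 𝕜) (φ := fun _ : ι => 𝕜) j).smulRight (F j q))
    (fun v => ?_) (fun v => ?_), rfl⟩
  · simpa using hsum v
  · ext i
    simp [hframe, Pi.single_apply]

theorem eventually_fderiv_symm [CompleteSpace E] (hΛ : IsDualCoframe F Λ p)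
    (hF : ∀ j, AnalyticAt 𝕜 (F j) p)
    (hcomm : ∀ i j, ∀ᶠ q in 𝓝 p, VectorField.lieBracket 𝕜 (F i) (F j) q = 0) :
    ∀ᶠ q in 𝓝 p, ∀ v w, fderiv 𝕜 Λ q v w = fderiv 𝕜 Λ q w v := by
  have hFd : ∀ᶠ q in 𝓝 p, ∀ j, DifferentiableAt 𝕜 (F j) q :=
    eventually_all.2 fun j => (hF j).eventually_analyticAt.mono fun _ h => h.differentiableAt
  filter_upwards [eventually_all.2 fun i => eventually_all.2 (hcomm i), hFd,
    hΛ.analyticAt.eventually_analyticAt, hΛ.sum_smul, hΛ.apply_frame.eventually_nhds]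
    with q hbracket hFd hΛq hsum hframe
  have hleibniz (j : ι) (v : E) : fderiv 𝕜 Λ q v (F j q) = -Λ q (fderiv 𝕜 (F j) q v) := by
    have hconst : (fun z => Λ z (F j z)) =ᶠ[𝓝 q] fun _ => Pi.single j 1 :=
      hframe.mono fun z hz => hz j
    have hderiv := congrArg (fun l => l v) (hconst.fderiv_eq (𝕜 := 𝕜))
    rw [fderiv_clm_apply hΛq.differentiableAt (hFd j)] at hderiv
    exact eq_neg_of_add_eq_zero_right (by simpa using hderiv)
  have hframe_symm (i j : ι) :
      fderiv 𝕜 Λ q (F i q) (F j q) = fderiv 𝕜 Λ q (F j q) (F i q) := by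
    rw [hleibniz, hleibniz, sub_eq_zero.1 (hbracket i j)]
  intro v w
  rw [← hsum v, ← hsum w]
  simp only [map_sum, map_smul, sum_apply, smul_apply, Finset.smul_sum]
  rw [Finset.sum_comm]
  refine Finset.sum_congr rfl fun i _ => Finset.sum_congr rfl fun j _ => ?_
  rw [hframe_symm j i, smul_comm]

theorem exists_primitive [CompleteSpace E] (hΛ : IsDualCoframe F Λ p)
    (hF : ∀ j, AnalyticAt 𝕜 (F j) p)
    (hcomm : ∀ i j, ∀ᶠ q in 𝓝 p, VectorField.lieBracket 𝕜 (F i) (F j) q = 0) :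
    ∃ φ : E → ι → 𝕜, φ p = 0 ∧ AnalyticAt 𝕜 φ p ∧ ∀ᶠ q in 𝓝 p, HasFDerivAt φ (Λ q) q := by
  let _ := NormedSpace.restrictScalars ℝ 𝕜 E
  obtain ⟨ε, hε, hball⟩ := Metric.eventually_nhds_iff_ball.1
    ((hΛ.eventually_fderiv_symm hF hcomm).and hΛ.analyticAt.eventually_analyticAt)
  obtain ⟨φ, hφ⟩ := (convex_ball p ε).exists_forall_hasFDerivAt_of_fderiv_symmetric
    (ω := Λ) Metric.isOpen_ball
    (fun q hq => ((hball q hq).2.differentiableAt.restrictScalars ℝ).differentiableWithinAt)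
    (fun q hq v w => by
      rw [(hball q hq).2.differentiableAt.fderiv_restrictScalars ℝ]
      exact (hball q hq).1 v w)
  have hφ' : ∀ᶠ q in 𝓝 p, HasFDerivAt (fun q => φ q - φ p) (Λ q) q := by
    filter_upwards [Metric.ball_mem_nhds p hε] with q hq using (hφ q hq).sub_const _
  exact ⟨_, sub_self _, analyticAt_of_hasFDerivAt hΛ.analyticAt hφ', hφ'⟩

end IsDualCoframe

/-- Analytic coordinates centred at `p` in which the vector fields `F j` are the coordinate fields
`∂/∂z_j`. -/
structure IsRectifyingChart (F : ι → E → E) (Φ : OpenPartialHomeomorph E (ι → 𝕜)) (p : E) :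
    Prop where
  mem_source : p ∈ Φ.source
  map_base : Φ p = 0
  analyticAt : ∀ q ∈ Φ.source, AnalyticAt 𝕜 Φ q
  analyticAt_symm : ∀ z ∈ Φ.target, AnalyticAt 𝕜 Φ.symm z
  fderiv_frame : ∀ q ∈ Φ.source, ∀ j, fderiv 𝕜 Φ q (F j q) = Pi.single j 1

theorem exists_isRectifyingChart [FiniteDimensional 𝕜 E] {F : ι → E → E} {p : E}
    (hF : ∀ j, AnalyticAt 𝕜 (F j) p) (hli : LinearIndependent 𝕜 fun j => F j p)
    (hcard : Fintype.card ι = Module.finrank 𝕜 E)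
    (hcomm : ∀ i j, ∀ᶠ q in 𝓝 p, VectorField.lieBracket 𝕜 (F i) (F j) q = 0) :
    ∃ Φ : OpenPartialHomeomorph E (ι → 𝕜), IsRectifyingChart F Φ p := by
  have : CompleteSpace E := FiniteDimensional.complete 𝕜 E
  obtain ⟨Λ, hΛ⟩ := exists_isDualCoframe hF hli hcard
  obtain ⟨φ, hφp, hφ, hφ'⟩ := hΛ.exists_primitive hF hcomm
  obtain ⟨s, hs, hso, hps⟩ := eventually_nhds_iff.1
    (hφ.eventually_analyticAt.and (hφ'.and (hΛ.apply_frame.and hΛ.eventually_exists_equiv)))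
  obtain ⟨-, hφp', -, e, he⟩ := hs p hps
  have hstrict : HasStrictFDerivAt φ (e : E →L[𝕜] (ι → 𝕜)) p := by
    rw [he, ← hφp'.fderiv]
    exact hφ.hasStrictFDerivAt
  let Φ := (hstrict.toOpenPartialHomeomorph φ).restrOpen s hso
  have hΦs (q : E) (hq : q ∈ Φ.source) : q ∈ s := hq.2
  refine ⟨Φ, ⟨hstrict.mem_toOpenPartialHomeomorph_source, hps⟩, hφp,
    fun q hq => (hs q (hΦs q hq)).1, fun z hz => ?_, fun q hq j => ?_⟩
  · obtain ⟨hφz, hφz', -, e', he'⟩ := hs _ (hΦs _ (Φ.map_target hz))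
    exact Φ.analyticAt_symm hz hφz (hφz'.fderiv.trans he'.symm)
  · obtain ⟨-, hφq', hframe, -⟩ := hs q (hΦs q hq)
    exact (congrArg (fun l => l (F j q)) hφq'.fderiv).trans (hframe j)

end Rectification

section ZeroSet

variable {F : Type*} [NormedAddCommGroup F] [NormedSpace ℝ F]

theorem exists_apply_eq_one {l : F →L[ℝ] ℝ} (hl : l ≠ 0) : ∃ n, l n = 1 :=
  LinearMap.surjective (f := (l : F →ₗ[ℝ] ℝ)) (by exact_mod_cast hl) 1

variable [CompleteSpace F]

theorem exists_straightening {r : F → ℝ} {r' : F →L[ℝ] ℝ} {p n : F}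
    (hr : HasStrictFDerivAt r r' p) (hn : r' n = 1) :
    ∃ Ψ : OpenPartialHomeomorph F F, p ∈ Ψ.source ∧ (∀ q, r' (Ψ q) = r q) ∧
      HasStrictFDerivAt Ψ.symm (ContinuousLinearMap.id ℝ F) (Ψ p) := by
  have hψ : HasStrictFDerivAt (fun q => q + (r q - r' q) • n)
      ((ContinuousLinearEquiv.refl ℝ F : F ≃L[ℝ] F) : F →L[ℝ] F) p := by
    simpa using (hasStrictFDerivAt_id p).fun_add ((hr.fun_sub r'.hasStrictFDerivAt).smul_const n)
  refine ⟨hψ.toOpenPartialHomeomorph _, hψ.mem_toOpenPartialHomeomorph_source, fun q => ?_,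
    hψ.to_localInverse⟩
  simp [hn]

theorem exists_norm_le_mul_of_vanishing {G : Type*} [NormedAddCommGroup G] [NormedSpace ℝ G]
    {r : F → ℝ} {r' : F →L[ℝ] ℝ} {g : F → G} {g' : F →L[ℝ] G} {p : F}
    (hr : HasStrictFDerivAt r r' p) (hr' : r' ≠ 0) (hrp : r p = 0) (hg : HasStrictFDerivAt g g' p)
    (h : ∀ᶠ q in 𝓝 p, r q = 0 → g q = 0) : ∃ C, ∀ᶠ q in 𝓝 p, ‖g q‖ ≤ C * ‖r q‖ := by
  obtain ⟨n, hn⟩ := exists_apply_eq_one hr'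
  obtain ⟨Ψ, hp, hΨ, hΨ'⟩ := exists_straightening hr hn
  have hsymm : Ψ.symm (Ψ p) = p := Ψ.left_inv hp
  obtain ⟨K, s, hs, hK⟩ :=
    (HasStrictFDerivAt.comp (g := g) (Ψ p) (hsymm.symm ▸ hg) hΨ').exists_lipschitzOnWith
  have hproj : Tendsto (fun q => Ψ q - r q • n) (𝓝 p) (𝓝 (Ψ p)) := by
    simpa [hrp] using
      (Ψ.continuousAt hp).tendsto.sub (hr.continuousAt.tendsto.smul_const n)
  have hproj' : Tendsto (fun q => Ψ.symm (Ψ q - r q • n)) (𝓝 p) (𝓝 p) := by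
    simpa only [hsymm, Function.comp_def] using
      (Ψ.symm.continuousAt (Ψ.map_source hp)).tendsto.comp hproj
  refine ⟨K * ‖n‖, ?_⟩
  filter_upwards [(Ψ.continuousAt hp).eventually hs, hproj.eventually hs, hproj'.eventually h,
    Ψ.open_source.mem_nhds hp, hproj.eventually (Ψ.open_target.mem_nhds (Ψ.map_source hp))]
    with q hqs hprojs hvanish hq hprojt
  have hg0 : g (Ψ.symm (Ψ q - r q • n)) = 0 := hvanish (by
    rw [← hΨ, Ψ.right_inv hprojt, map_sub, map_smul, hn, hΨ, smul_eq_mul, mul_one, sub_self])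
  have hdist := hK.dist_le_mul _ hqs _ hprojs
  rw [hg0, Ψ.left_inv hq, dist_zero_right, dist_eq_norm, sub_sub_cancel, norm_smul] at hdist
  calc ‖g q‖ ≤ K * (‖r q‖ * ‖n‖) := hdist
    _ = K * ‖n‖ * ‖r q‖ := by ring

end ZeroSet

section Tube

variable {ι : Type*}

/-- Componentwise real part. -/
noncomputable def rePart : (ι → ℂ) →L[ℝ] (ι → ℝ) :=
  .piMap fun _ => Complex.reCLM

/-- Componentwise imaginary part. -/
noncomputable def imPart : (ι → ℂ) →L[ℝ] (ι → ℝ) :=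
  .piMap fun _ => Complex.imCLM

/-- The inclusion of `ℝ^ι` in `ℂ^ι`. -/
noncomputable def ofRealPi : (ι → ℝ) →L[ℝ] (ι → ℂ) :=
  .piMap fun _ => Complex.ofRealCLM

@[simp] theorem rePart_apply (z : ι → ℂ) (k : ι) : rePart z k = (z k).re := rfl

@[simp] theorem imPart_apply (z : ι → ℂ) (k : ι) : imPart z k = (z k).im := rfl

@[simp] theorem ofRealPi_apply (x : ι → ℝ) (k : ι) : ofRealPi x k = (x k : ℂ) := rfl

@[simp] theorem rePart_ofRealPi (x : ι → ℝ) : rePart (ofRealPi x) = x := by ext; simp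

@[simp] theorem imPart_ofRealPi (x : ι → ℝ) : imPart (ofRealPi x) = 0 := by ext; simp

@[simp] theorem rePart_I_smul (z : ι → ℂ) : rePart (Complex.I • z) = -imPart z := by ext; simp

@[simp] theorem imPart_I_smul (z : ι → ℂ) : imPart (Complex.I • z) = rePart z := by ext; simp

theorem ofRealPi_rePart_add (z : ι → ℂ) :
    ofRealPi (rePart z) + Complex.I • ofRealPi (imPart z) = z := by
  ext k
  simp [mul_comm Complex.I, Complex.re_add_im]

theorem fderiv_comp_ofRealPi_ne_zero [Finite ι] {r : (ι → ℂ) → ℝ} {x : ι → ℝ}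
    (hr : DifferentiableAt ℝ r (ofRealPi x)) (hr' : fderiv ℝ r (ofRealPi x) ≠ 0)
    (h : (fderiv ℝ r (ofRealPi x)).comp (Complex.I • ofRealPi) = 0) :
    fderiv ℝ (r ∘ ofRealPi) x ≠ 0 := by
  cases nonempty_fintype ι
  rw [fderiv_comp x hr ofRealPi.differentiableAt, ofRealPi.fderiv]
  refine fun hzero => hr' (ContinuousLinearMap.ext fun v => ?_)
  calc fderiv ℝ r (ofRealPi x) v
      = fderiv ℝ r (ofRealPi x) (ofRealPi (rePart v))
          + fderiv ℝ r (ofRealPi x) (Complex.I • ofRealPi (imPart v)) := by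
        rw [← map_add, ofRealPi_rePart_add]
    _ = 0 := by
        rw [show fderiv ℝ r (ofRealPi x) (ofRealPi (rePart v)) = 0 from congr($hzero (rePart v)),
          show fderiv ℝ r (ofRealPi x) (Complex.I • ofRealPi (imPart v)) = 0 from
            congr($h (imPart v)), add_zero]

variable [Fintype ι]

theorem I_smul_ofRealPi [DecidableEq ι] (y : ι → ℝ) :
    Complex.I • ofRealPi y = ∑ j, (y j : ℂ) • (Pi.single j Complex.I : ι → ℂ) := by
  ext i
  simp [Finset.sum_apply, Pi.single_apply, mul_comm]

theorem eq_zero_of_rePart_eq {r : (ι → ℂ) → ℝ} {s : Set (ι → ℂ)} {C : ℝ} {a b : ι → ℂ}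
    (hs : Convex ℝ s) (hr : ∀ z ∈ s, DifferentiableAt ℝ r z)
    (hC : ∀ z ∈ s, ‖(fderiv ℝ r z).comp (Complex.I • ofRealPi)‖ ≤ C * ‖r z‖)
    (ha : a ∈ s) (hb : b ∈ s) (hab : rePart a = rePart b) (hra : r a = 0) : r b = 0 := by
  have hseg := hs.segment_subset ha hb
  refine eq_zero_of_norm_fderiv_le_on_segment (K := C * ‖imPart (b - a)‖)
    (fun z hz => hr z (hseg hz)) (fun z hz => ?_) hra
  have hba : b - a = (Complex.I • ofRealPi) (imPart (b - a)) := by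
    conv_lhs =>
      rw [← ofRealPi_rePart_add (b - a), map_sub rePart, hab, sub_self, map_zero, zero_add]
    rfl
  calc ‖fderiv ℝ r z (b - a)‖
      = ‖(fderiv ℝ r z).comp (Complex.I • ofRealPi) (imPart (b - a))‖ := by
        rw [ContinuousLinearMap.comp_apply, ← hba]
    _ ≤ C * ‖r z‖ * ‖imPart (b - a)‖ := ContinuousLinearMap.le_of_opNorm_le _ (hC z (hseg hz)) _
    _ = C * ‖imPart (b - a)‖ * ‖r z‖ := by ring

theorem eventually_eq_zero_iff_of_imaginary_tangent {r : (ι → ℂ) → ℝ} {x : ι → ℝ}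
    (hr : AnalyticAt ℝ r (ofRealPi x)) (hr' : fderiv ℝ r (ofRealPi x) ≠ 0)
    (hrx : r (ofRealPi x) = 0)
    (h : ∀ᶠ z in 𝓝 (ofRealPi x), r z = 0 → (fderiv ℝ r z).comp (Complex.I • ofRealPi) = 0) :
    ∀ᶠ z in 𝓝 (ofRealPi x), r z = 0 ↔ r (ofRealPi (rePart z)) = 0 := by
  obtain ⟨C, hC⟩ := exists_norm_le_mul_of_vanishing hr.hasStrictFDerivAt hr' hrx
    (hr.fderiv.hasStrictFDerivAt.clm_comp (hasStrictFDerivAt_const _ _)) h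
  obtain ⟨ε, hε, hball⟩ := Metric.eventually_nhds_iff_ball.1 (hC.and hr.eventually_analyticAt)
  have hproj : Tendsto (fun z => ofRealPi (rePart z)) (𝓝 (ofRealPi x)) (𝓝 (ofRealPi x)) := by
    simpa [Function.comp_def] using
      (ofRealPi.continuous.comp rePart.continuous).tendsto (ofRealPi x)
  have hmem := Metric.ball_mem_nhds (ofRealPi x) hε
  filter_upwards [hmem, hproj.eventually hmem] with z hz hz'
  have heq {a b : ι → ℂ} (ha : a ∈ Metric.ball (ofRealPi x) ε)
      (hb : b ∈ Metric.ball (ofRealPi x) ε) (hab : rePart a = rePart b) (hra : r a = 0) :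
      r b = 0 :=
    eq_zero_of_rePart_eq (convex_ball _ _) (fun z hz => (hball z hz).2.differentiableAt)
      (fun z hz => (hball z hz).1) ha hb hab hra
  exact ⟨heq hz hz' (rePart_ofRealPi _).symm, heq hz' hz (rePart_ofRealPi _)⟩

end Tube

namespace IsRectifyingChart

variable {𝕜 E ι : Type*} [RCLike 𝕜] [NormedAddCommGroup E] [NormedSpace 𝕜 E] [Fintype ι]
  [DecidableEq ι] {F : ι → E → E} {Φ : OpenPartialHomeomorph E (ι → 𝕜)} {p q : E}

theorem zero_mem_target (hΦ : IsRectifyingChart F Φ p) : 0 ∈ Φ.target :=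
  hΦ.map_base ▸ Φ.map_source hΦ.mem_source

theorem symm_zero (hΦ : IsRectifyingChart F Φ p) : Φ.symm 0 = p := by
  rw [← hΦ.map_base, Φ.left_inv hΦ.mem_source]

theorem tendsto (hΦ : IsRectifyingChart F Φ p) : Tendsto Φ (𝓝 p) (𝓝 0) := by
  simpa only [hΦ.map_base] using (Φ.continuousAt hΦ.mem_source).tendsto

theorem tendsto_symm (hΦ : IsRectifyingChart F Φ p) : Tendsto Φ.symm (𝓝 0) (𝓝 p) := by
  simpa only [hΦ.symm_zero] using (Φ.symm.continuousAt hΦ.zero_mem_target).tendsto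

theorem fderiv_symm_fderiv (hΦ : IsRectifyingChart F Φ p) (hq : q ∈ Φ.source) (v : E) :
    fderiv 𝕜 Φ.symm (Φ q) (fderiv 𝕜 Φ q v) = v :=
  fderiv_symm_apply_fderiv hq (hΦ.analyticAt q hq).differentiableAt
    (hΦ.analyticAt_symm _ (Φ.map_source hq)).differentiableAt v

theorem fderiv_fderiv_symm (hΦ : IsRectifyingChart F Φ p) (hq : q ∈ Φ.source) (w : ι → 𝕜) :
    fderiv 𝕜 Φ q (fderiv 𝕜 Φ.symm (Φ q) w) = w := by
  have hsymm := fderiv_symm_apply_fderiv (Φ := Φ.symm) (Φ.map_source hq)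
    (hΦ.analyticAt_symm _ (Φ.map_source hq)).differentiableAt
  rw [Φ.symm_symm, Φ.left_inv hq] at hsymm
  exact hsymm (hΦ.analyticAt q hq).differentiableAt w

theorem isDualCoframe (hΦ : IsRectifyingChart F Φ p) :
    IsDualCoframe F (fderiv 𝕜 Φ) p where
  analyticAt := (hΦ.analyticAt p hΦ.mem_source).fderiv
  apply_frame := (Φ.open_source.eventually_mem hΦ.mem_source).mono hΦ.fderiv_frame
  sum_smul := (Φ.open_source.eventually_mem hΦ.mem_source).mono fun q hq v => by
    conv_rhs => rw [← hΦ.fderiv_symm_fderiv hq v, ← Finset.univ_sum_single (fderiv 𝕜 Φ q v)]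
    rw [map_sum]
    refine Finset.sum_congr rfl fun j _ => ?_
    conv_lhs => rw [← hΦ.fderiv_symm_fderiv hq (F j q), hΦ.fderiv_frame q hq j, ← map_smul]
    rw [← Pi.single_smul, smul_eq_mul, mul_one]

end IsRectifyingChart

namespace IsRectifyingChart

variable {E ι : Type*} [NormedAddCommGroup E] [NormedSpace ℂ E] [Fintype ι] [DecidableEq ι]
  {F : ι → E → E} {Φ : OpenPartialHomeomorph E (ι → ℂ)} {p q : E} {r : E → ℝ}

theorem fderiv_comp_symm (hΦ : IsRectifyingChart F Φ p) (hq : q ∈ Φ.source)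
    (hr : DifferentiableAt ℝ r q) (v : E) :
    fderiv ℝ (r ∘ Φ.symm) (Φ q) (fderiv ℂ Φ q v) = fderiv ℝ r q v := by
  have hcomp : HasFDerivAt (r ∘ Φ.symm) _ (Φ q) :=
    HasFDerivAt.comp (Φ q) (by rw [Φ.left_inv hq]; exact hr.hasFDerivAt)
      ((hΦ.analyticAt_symm _ (Φ.map_source hq)).differentiableAt.hasFDerivAt.restrictScalars ℝ)
  rw [hcomp.fderiv]
  exact congrArg (fderiv ℝ r q) (hΦ.fderiv_symm_fderiv hq v)

theorem eventually_imaginary_tangent (hΦ : IsRectifyingChart F Φ p) (hr : AnalyticAt ℝ r p)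
    (htan : ∀ᶠ q in 𝓝 p, r q = 0 → ∀ j, fderiv ℝ r q (Complex.I • F j q) = 0) :
    ∀ᶠ z in 𝓝 0, (r ∘ Φ.symm) z = 0 →
      (fderiv ℝ (r ∘ Φ.symm) z).comp (Complex.I • ofRealPi) = 0 := by
  filter_upwards [hΦ.tendsto_symm.eventually (htan.and hr.eventually_analyticAt),
    Φ.open_target.mem_nhds hΦ.zero_mem_target] with z ⟨htan, hrz⟩ hz hz0
  have hzero (j : ι) : fderiv ℝ (r ∘ Φ.symm) z (Pi.single j Complex.I) = 0 := by
    have hsingle : fderiv ℂ Φ (Φ.symm z) (Complex.I • F j (Φ.symm z)) = Pi.single j Complex.I := by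
      rw [map_smul, hΦ.fderiv_frame _ (Φ.map_target hz), ← Pi.single_smul, smul_eq_mul, mul_one]
    have hcomp := hΦ.fderiv_comp_symm (Φ.map_target hz) hrz.differentiableAt
      (Complex.I • F j (Φ.symm z))
    rwa [hsingle, Φ.right_inv hz, htan hz0 j] at hcomp
  ext y
  change fderiv ℝ (r ∘ Φ.symm) z (Complex.I • ofRealPi y) = 0
  simp only [I_smul_ofRealPi, Complex.coe_smul, map_sum, map_smul, hzero, smul_zero,
    Finset.sum_const_zero]

theorem exists_tube_base (hΦ : IsRectifyingChart F Φ p) (hr : AnalyticAt ℝ r p)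
    (hr' : fderiv ℝ r p ≠ 0) (hrp : r p = 0)
    (htan : ∀ᶠ q in 𝓝 p, r q = 0 → ∀ j, fderiv ℝ r q (Complex.I • F j q) = 0) :
    ∃ ρ : (ι → ℝ) → ℝ, AnalyticAt ℝ ρ 0 ∧ fderiv ℝ ρ 0 ≠ 0 ∧
      ∀ᶠ q in 𝓝 p, r q = 0 ↔ ρ (rePart (Φ q)) = 0 := by
  have hR : AnalyticAt ℝ (r ∘ Φ.symm) (ofRealPi 0) := by
    rw [map_zero]
    exact AnalyticAt.comp (by rwa [hΦ.symm_zero])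
      (hΦ.analyticAt_symm 0 hΦ.zero_mem_target).restrictScalars
  have hR' : fderiv ℝ (r ∘ Φ.symm) (ofRealPi 0) ≠ 0 := fun hzero =>
    hr' (ContinuousLinearMap.ext fun v => by
      have hcomp := hΦ.fderiv_comp_symm hΦ.mem_source hr.differentiableAt v
      rw [hΦ.map_base, ← map_zero ofRealPi, hzero] at hcomp
      exact hcomp.symm)
  have hRz : (r ∘ Φ.symm) (ofRealPi 0) = 0 := by
    rw [map_zero, Function.comp_apply, hΦ.symm_zero, hrp]
  have hRtan := hΦ.eventually_imaginary_tangent hr htan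
  rw [← map_zero ofRealPi] at hRtan
  have htube := eventually_eq_zero_iff_of_imaginary_tangent hR hR' hRz hRtan
  rw [map_zero] at htube
  refine ⟨(r ∘ Φ.symm) ∘ ofRealPi, hR.comp (ContinuousLinearMap.analyticAt (ofRealPi (ι := ι)) 0),
    fderiv_comp_ofRealPi_ne_zero hR.differentiableAt hR' (hRtan.self_of_nhds hRz), ?_⟩
  filter_upwards [hΦ.tendsto.eventually htube, Φ.open_source.mem_nhds hΦ.mem_source] with q hq hqs
  rwa [Function.comp_apply, Φ.left_inv hqs] at hq

end IsRectifyingChart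

section TubeChart

open HolVectorField

/-- Holomorphic coordinates `Φ` centred at `p` in which the vector fields `f j` are the constant
fields `i ∂/∂z_j` and `M` is the tube over the zero set of `ρ`. -/
structure IsTubeChart (M : Set (Fin 3 → ℂ)) (p : Fin 3 → ℂ) (f : Fin 3 → HolVectorField p)
    (Φ : OpenPartialHomeomorph (Fin 3 → ℂ) (Fin 3 → ℂ)) (ρ : (Fin 3 → ℝ) → ℝ) : Prop
    extends IsRectifyingChart (fun j => -Complex.I • rep (f j)) Φ p where
  analyticAt_base : AnalyticAt ℝ ρ 0
  fderiv_base : fderiv ℝ ρ 0 ≠ 0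
  mem_iff : ∀ᶠ q in 𝓝 p, q ∈ M ↔ ρ (rePart (Φ q)) = 0

theorem exists_isTubeChart {M : Set (Fin 3 → ℂ)} {p : Fin 3 → ℂ} {r : (Fin 3 → ℂ) → ℝ}
    (hr : IsLocalDefiningFunction M p r) (hp : p ∈ M) {f : Fin 3 → HolVectorField p}
    (hf : ∀ j, f j ∈ hol M p) (hcomm : ∀ i j, ⁅f i, f j⁆ = 0)
    (hli : LinearIndependent ℂ fun j => eval (f j)) : ∃ Φ ρ, IsTubeChart M p f Φ ρ := by
  obtain ⟨Φ, hΦ⟩ : ∃ Φ, IsRectifyingChart (fun j => -Complex.I • rep (f j)) Φ p := by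
    refine exists_isRectifyingChart (fun j => (analyticAt_rep _).const_smul) ?_ (by simp)
      fun i j => ?_
    · simp only [Pi.smul_apply, rep_self]
      exact hli.units_smul fun _ => Units.mk0 (-Complex.I) (neg_ne_zero.2 Complex.I_ne_zero)
    · have hrep := rep_lie (f i) (f j)
      rw [hcomm i j] at hrep
      filter_upwards [rep_zero, hrep, (analyticAt_rep (f i)).eventually_analyticAt,
        (analyticAt_rep (f j)).eventually_analyticAt] with q h0 hij hi hj
      rw [VectorField.lieBracket_const_smul_left hi.differentiableAt,
        VectorField.lieBracket_const_smul_right hj.differentiableAt, ← hij, h0, smul_zero,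
        smul_zero]
  obtain ⟨ρ, hρ, hρ', hmem⟩ := hΦ.exists_tube_base hr.1 hr.2.1 (hr.2.2.self_of_nhds.1 hp) <| by
    filter_upwards [eventually_all.2 fun j => eventually_fderiv_rep_eq_zero hr (hf j), hr.2.2]
      with q htan hq hrq j
    simpa [smul_smul] using htan j (hq.2 hrq)
  exact ⟨Φ, ρ, hΦ, hρ, hρ', by filter_upwards [hr.2.2, hmem] with q hq hq' using hq.trans hq'⟩

end TubeChart

section Complexification

variable {ι : Type*} [Finite ι]

/-- The complex-linear extension to `ℂ^ι` of a real-linear endomorphism of `ℝ^ι`. -/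
noncomputable def complexExtension (L : (ι → ℝ) →ₗ[ℝ] (ι → ℝ)) : (ι → ℂ) →L[ℂ] (ι → ℂ) where
  toFun z := ofRealPi (L (rePart z)) + Complex.I • ofRealPi (L (imPart z))
  map_add' z w := by simp only [map_add, smul_add]; abel
  map_smul' c z := by
    have hre : rePart (c • z) = c.re • rePart z - c.im • imPart z := by ext; simp
    have him : imPart (c • z) = c.re • imPart z + c.im • rePart z := by ext; simp
    simp only [hre, him, map_add, map_sub, map_smul]
    ext k
    apply Complex.ext <;> simp
  cont := by
    have hL : Continuous L := L.continuous_of_finiteDimensional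
    fun_prop

theorem complexExtension_apply (L : (ι → ℝ) →ₗ[ℝ] (ι → ℝ)) (z : ι → ℂ) :
    complexExtension L z = ofRealPi (L (rePart z)) + Complex.I • ofRealPi (L (imPart z)) := rfl

theorem complexExtension_ofRealPi (L : (ι → ℝ) →ₗ[ℝ] (ι → ℝ)) (x : ι → ℝ) :
    complexExtension L (ofRealPi x) = ofRealPi (L x) := by
  simp [complexExtension_apply]

/-- The complex affine vector field with linear part that of `A` and constant term `A 0 + i c`. -/
noncomputable def complexify (A : (ι → ℝ) →ᵃ[ℝ] (ι → ℝ)) (c : ι → ℝ) (z : ι → ℂ) : ι → ℂ :=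
  complexExtension A.linear z + (ofRealPi (A 0) + Complex.I • ofRealPi c)

theorem rePart_complexify (A : (ι → ℝ) →ᵃ[ℝ] (ι → ℝ)) (c : ι → ℝ) (z : ι → ℂ) :
    rePart (complexify A c z) = A (rePart z) := by
  rw [A.decomp]
  simp [complexify, complexExtension_apply]

theorem complexify_zero (A : (ι → ℝ) →ᵃ[ℝ] (ι → ℝ)) (c : ι → ℝ) :
    complexify A c 0 = ofRealPi (A 0) + Complex.I • ofRealPi c := by
  rw [complexify, map_zero, zero_add]

theorem complexify_add (A B : (ι → ℝ) →ᵃ[ℝ] (ι → ℝ)) (c d : ι → ℝ) (z : ι → ℂ) :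
    complexify (A + B) (c + d) z = complexify A c z + complexify B d z := by
  simp only [complexify, complexExtension_apply, AffineMap.add_linear, LinearMap.add_apply,
    AffineMap.coe_add, Pi.add_apply, map_add, smul_add]
  abel

theorem complexify_smul (a : ℝ) (A : (ι → ℝ) →ᵃ[ℝ] (ι → ℝ)) (c : ι → ℝ) (z : ι → ℂ) :
    complexify (a • A) (a • c) z = a • complexify A c z := by
  simp only [complexify, complexExtension_apply, AffineMap.smul_linear, LinearMap.smul_apply,
    AffineMap.coe_smul, Pi.smul_apply, map_smul, smul_add, smul_comm a Complex.I]

theorem hasFDerivAt_complexify (A : (ι → ℝ) →ᵃ[ℝ] (ι → ℝ)) (c : ι → ℝ) (z : ι → ℂ) :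
    HasFDerivAt (complexify A c) (complexExtension A.linear) z := by
  cases nonempty_fintype ι
  exact (complexExtension A.linear).hasFDerivAt.add_const _

theorem eq_zero_of_eventually_complexify_eq_zero {A : (ι → ℝ) →ᵃ[ℝ] (ι → ℝ)} {c : ι → ℝ}
    (h : ∀ᶠ z in 𝓝 0, complexify A c z = 0) : A = 0 ∧ c = 0 := by
  cases nonempty_fintype ι
  have hreal : ∀ᶠ x in 𝓝 (0 : ι → ℝ), A x = 0 := by
    have htendsto : Tendsto ofRealPi (𝓝 (0 : ι → ℝ)) (𝓝 0) := by
      simpa only [map_zero] using ofRealPi.continuous.tendsto (0 : ι → ℝ)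
    filter_upwards [htendsto.eventually h] with x hx
    have hre := rePart_complexify A c (ofRealPi x)
    rwa [hx, map_zero, rePart_ofRealPi, eq_comm] at hre
  obtain ⟨U, hU, hUo, h0⟩ := eventually_nhds_iff.1 hreal
  have hc := h.self_of_nhds
  rw [complexify_zero, hreal.self_of_nhds, map_zero, zero_add] at hc
  exact ⟨AffineMap.ext_on (hUo.affineSpan_eq_top ⟨0, h0⟩) fun x hx => hU x hx,
    by simpa using congrArg imPart hc⟩

theorem analyticAt_complexify [Fintype ι] (A : (ι → ℝ) →ᵃ[ℝ] (ι → ℝ)) (c : ι → ℝ) (z : ι → ℂ) :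
    AnalyticAt ℂ (complexify A c) z :=
  ((complexExtension A.linear).analyticAt z).add analyticAt_const

end Complexification

namespace IsRectifyingChart

theorem eventually_fderiv_fderiv_apply {𝕜 E ι : Type*} [RCLike 𝕜] [NormedAddCommGroup E]
    [NormedSpace 𝕜 E] [CompleteSpace E] [Fintype ι] [DecidableEq ι] {F : ι → E → E}
    {Φ : OpenPartialHomeomorph E (ι → 𝕜)} {p : E} (hΦ : IsRectifyingChart F Φ p) {k : ι}
    (hF : AnalyticAt 𝕜 (F k) p) {X : E → E} (hX : AnalyticAt 𝕜 X p) :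
    ∀ᶠ q in 𝓝 p, fderiv 𝕜 (fun q => fderiv 𝕜 Φ q (X q)) q (F k q)
      = fderiv 𝕜 Φ q (VectorField.lieBracket 𝕜 (F k) X q) := by
  filter_upwards [(Φ.open_source.eventually_mem hΦ.mem_source).eventually_nhds,
    hF.eventually_analyticAt, hX.eventually_analyticAt] with q hq hFq hXq
  have hconst : (fun x => fderiv 𝕜 Φ x (F k x)) =ᶠ[𝓝 q] fun _ => Pi.single k 1 :=
    hq.mono fun x hx => hΦ.fderiv_frame x hx k
  rw [VectorField.fderiv_apply_lieBracket (n := minSmoothness 𝕜 2)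
    (hΦ.analyticAt q hq.self_of_nhds).contDiffAt le_rfl hXq.differentiableAt
    hFq.differentiableAt, hconst.fderiv_eq, fderiv_fun_const]
  simp

end IsRectifyingChart

section AffineSymmetries

open HolVectorField

/-- The affine vector fields on `E` that are tangent to the zero set of `ρ` near `x₀`. -/
def affSymmetriesNear {E : Type*} [NormedAddCommGroup E] [NormedSpace ℝ E] (ρ : E → ℝ) (x₀ : E) :
    Submodule ℝ (E →ᵃ[ℝ] E) where
  carrier := {A | ∀ᶠ x in 𝓝 x₀, ρ x = 0 → fderiv ℝ ρ x (A x) = 0}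
  add_mem' := fun {A B} hA hB => by
    filter_upwards [hA, hB] with x hAx hBx hx
    rw [AffineMap.coe_add, Pi.add_apply, map_add, hAx hx, hBx hx, add_zero]
  zero_mem' := Eventually.of_forall fun _ _ => map_zero _
  smul_mem' := fun c A hA => by
    filter_upwards [hA] with x hAx hx
    rw [AffineMap.coe_smul, Pi.smul_apply, map_smul, hAx hx, smul_zero]

theorem mem_affSymmetriesNear_iff {E : Type*} [NormedAddCommGroup E] [NormedSpace ℝ E]
    {ρ : E → ℝ} {x₀ : E} {A : E →ᵃ[ℝ] E} :
    A ∈ affSymmetriesNear ρ x₀ ↔ ∀ᶠ x in 𝓝 x₀, ρ x = 0 → fderiv ℝ ρ x (A x) = 0 := Iff.rfl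

/-- Evaluation at the point `x`, on a space of affine vector fields. -/
def affineEval {E : Type*} [NormedAddCommGroup E] [NormedSpace ℝ E]
    (V : Submodule ℝ (E →ᵃ[ℝ] E)) (x : E) : V →ₗ[ℝ] E where
  toFun A := A.1 x
  map_add' _ _ := rfl
  map_smul' _ _ := rfl

namespace IsTubeChart

variable {M : Set (Fin 3 → ℂ)} {p : Fin 3 → ℂ} {f : Fin 3 → HolVectorField p}
  {Φ : OpenPartialHomeomorph (Fin 3 → ℂ) (Fin 3 → ℂ)} {ρ : (Fin 3 → ℝ) → ℝ}

theorem tendsto_rePart (hT : IsTubeChart M p f Φ ρ) :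
    Tendsto (fun q => rePart (Φ q)) (𝓝 p) (𝓝 0) := by
  have h : Tendsto rePart (𝓝 (0 : Fin 3 → ℂ)) (𝓝 0) := by
    simpa only [map_zero] using rePart.continuous.tendsto (0 : Fin 3 → ℂ)
  exact h.comp hT.tendsto

theorem base_zero (hT : IsTubeChart M p f Φ ρ) (hp : p ∈ M) : ρ 0 = 0 := by
  simpa only [hT.map_base, map_zero] using hT.mem_iff.self_of_nhds.1 hp

theorem eventually_fderiv_base (hT : IsTubeChart M p f Φ ρ) : ∀ᶠ q in 𝓝 p, ∀ v,
    fderiv ℝ (fun q => ρ (rePart (Φ q))) q v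
      = fderiv ℝ ρ (rePart (Φ q)) (rePart (fderiv ℂ Φ q v)) := by
  filter_upwards [hT.tendsto_rePart.eventually hT.analyticAt_base.eventually_analyticAt,
    Φ.open_source.mem_nhds hT.mem_source] with q hρ hq v
  have hrePart : HasFDerivAt (fun q => rePart (Φ q))
      (rePart.comp ((fderiv ℂ Φ q).restrictScalars ℝ)) q :=
    rePart.hasFDerivAt.comp q
      ((hT.analyticAt q hq).differentiableAt.hasFDerivAt.restrictScalars ℝ)
  have hcomp : HasFDerivAt (fun q => ρ (rePart (Φ q))) _ q :=
    hρ.differentiableAt.hasFDerivAt.comp q hrePart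
  rw [hcomp.fderiv]
  rfl

theorem isLocalDefiningFunction (hT : IsTubeChart M p f Φ ρ) :
    IsLocalDefiningFunction M p fun q => ρ (rePart (Φ q)) := by
  refine ⟨?_, fun hzero => hT.fderiv_base (ContinuousLinearMap.ext fun x => ?_), hT.mem_iff⟩
  · refine AnalyticAt.fun_comp (g := ρ) (by simpa [hT.map_base] using hT.analyticAt_base) ?_
    exact (rePart.analyticAt _).fun_comp (hT.analyticAt p hT.mem_source).restrictScalars
  · have hbase := hT.eventually_fderiv_base.self_of_nhds (fderiv ℂ Φ.symm (Φ p) (ofRealPi x))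
    rw [hT.fderiv_fderiv_symm hT.mem_source, hzero, hT.map_base, map_zero,
      rePart_ofRealPi] at hbase
    exact hbase.symm

/-- The holomorphic vector fields that are affine with real linear part in a tube chart: the
pullback of `complexify A c`, as a real-linear function of the pair `(A, c)`. -/
noncomputable def affineField (hT : IsTubeChart M p f Φ ρ) :
    (((Fin 3 → ℝ) →ᵃ[ℝ] (Fin 3 → ℝ)) × (Fin 3 → ℝ)) →ₗ[ℝ] HolVectorField p where
  toFun a := ofAnalytic (fun q => fderiv ℂ Φ.symm (Φ q) (complexify a.1 a.2 (Φ q))) <| by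
    have hΦ := hT.analyticAt p hT.mem_source
    have hsymm := (hT.analyticAt_symm _ (Φ.map_source hT.mem_source)).fderiv.fun_comp hΦ
    have hA := (analyticAt_complexify a.1 a.2 _).fun_comp hΦ
    exact (hsymm.contDiffAt.clm_apply hA.contDiffAt).analyticAt
  map_add' a b := Subtype.ext <| Germ.coe_eq.2 <| Eventually.of_forall fun q => by
    simp only [Prod.fst_add, Prod.snd_add, complexify_add, map_add]
  map_smul' c a := Subtype.ext <| Germ.coe_eq.2 <| Eventually.of_forall fun q => by
    simp only [Prod.smul_fst, Prod.smul_snd, complexify_smul]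
    exact ContinuousLinearMap.map_smul_of_tower _ c _

variable {A : (Fin 3 → ℝ) →ᵃ[ℝ] (Fin 3 → ℝ)} {c : Fin 3 → ℝ}

theorem rep_affineField (hT : IsTubeChart M p f Φ ρ) :
    rep (hT.affineField (A, c)) =ᶠ[𝓝 p] fun q => fderiv ℂ Φ.symm (Φ q) (complexify A c (Φ q)) :=
  rep_eventuallyEq rfl

theorem eventually_fderiv_rep_affineField (hT : IsTubeChart M p f Φ ρ) :
    ∀ᶠ q in 𝓝 p, fderiv ℂ Φ q (rep (hT.affineField (A, c)) q) = complexify A c (Φ q) := by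
  filter_upwards [hT.rep_affineField (A := A) (c := c), Φ.open_source.mem_nhds hT.mem_source]
    with q hrep hq
  rw [hrep, hT.fderiv_fderiv_symm hq]

theorem eval_affineField_eq_zero (hT : IsTubeChart M p f Φ ρ) (hA : A 0 = 0) :
    eval (hT.affineField (A, 0)) = 0 := by
  rw [← rep_self, hT.rep_affineField.self_of_nhds]
  simp [hT.map_base, complexify_zero, hA]

theorem affineField_injective (hT : IsTubeChart M p f Φ ρ) :
    Function.Injective hT.affineField := by
  rw [injective_iff_map_eq_zero]
  rintro ⟨A, c⟩ h
  have hrep := hT.eventually_fderiv_rep_affineField (A := A) (c := c)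
  rw [h] at hrep
  have hzero : ∀ᶠ z in 𝓝 0, complexify A c z = 0 := by
    filter_upwards [hT.tendsto_symm.eventually (hrep.and rep_zero),
      Φ.open_target.mem_nhds hT.zero_mem_target] with z ⟨hz, hz0⟩ hzt
    rwa [hz0, map_zero, Φ.right_inv hzt, eq_comm] at hz
  obtain ⟨rfl, rfl⟩ := eq_zero_of_eventually_complexify_eq_zero hzero
  rfl

theorem affineField_mem_hol_iff (hT : IsTubeChart M p f Φ ρ) :
    hT.affineField (A, c) ∈ hol M p ↔ A ∈ affSymmetriesNear ρ 0 := by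
  have htangent : ∀ᶠ q in 𝓝 p,
      fderiv ℝ (fun q => ρ (rePart (Φ q))) q (rep (hT.affineField (A, c)) q)
        = fderiv ℝ ρ (rePart (Φ q)) (A (rePart (Φ q))) := by
    filter_upwards [hT.eventually_fderiv_base,
      hT.eventually_fderiv_rep_affineField (A := A) (c := c)] with q hbase hrep
    rw [hbase, hrep, rePart_complexify]
  rw [mem_hol_iff hT.isLocalDefiningFunction EventuallyEq.rfl, mem_affSymmetriesNear_iff]
  refine ⟨fun h => ?_, fun h => ?_⟩
  · have hreal : Tendsto ofRealPi (𝓝 (0 : Fin 3 → ℝ)) (𝓝 0) := by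
      simpa only [map_zero] using ofRealPi.continuous.tendsto (0 : Fin 3 → ℝ)
    filter_upwards [(hT.tendsto_symm.comp hreal).eventually (h.and (htangent.and hT.mem_iff)),
      hreal.eventually (Φ.open_target.mem_nhds hT.zero_mem_target)] with x ⟨hx, hxA, hxM⟩ hxt hx0
    rw [Function.comp_apply, Φ.right_inv hxt, rePart_ofRealPi] at hxA hxM
    rw [← hxA]
    exact hx (hxM.2 hx0)
  · filter_upwards [hT.tendsto_rePart.eventually h, htangent, hT.mem_iff] with q hq hqA hqM hqm
    rw [hqA]
    exact hq (hqM.1 hqm)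

theorem eventually_fderiv_fderiv_rep (hT : IsTubeChart M p f Φ ρ) {g : HolVectorField p}
    {k : Fin 3} (hg : ⁅f k, g⁆ = ∑ j, c j • f j) :
    ∀ᶠ q in 𝓝 p, fderiv ℂ (fun q => fderiv ℂ Φ q (rep g q)) q (-Complex.I • rep (f k) q)
      = ofRealPi c := by
  have hsum := rep_sum Finset.univ fun j => c j • f j
  rw [← hg] at hsum
  filter_upwards [hT.eventually_fderiv_fderiv_apply ((analyticAt_rep (f k)).const_smul)
      (analyticAt_rep g), rep_lie (f k) g, hsum,
    eventually_all.2 fun j => rep_smul (c j : ℂ) (f j),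
    (analyticAt_rep (f k)).eventually_analyticAt, Φ.open_source.mem_nhds hT.mem_source]
    with q hfderiv hlie hsum hsmul hfk hq
  refine hfderiv.trans ?_
  have hframe (j : Fin 3) : -Complex.I • fderiv ℂ Φ q (rep (f j) q) = Pi.single j 1 := by
    rw [← map_smul]
    exact hT.fderiv_frame q hq j
  rw [VectorField.lieBracket_const_smul_left hfk.differentiableAt, ← hlie, hsum]
  simp only [← algebraMap_smul ℂ (_ : ℝ) (f _), Complex.coe_algebraMap, hsmul, Finset.smul_sum,
    map_sum, map_smul, smul_comm (-Complex.I), hframe]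
  ext i
  simp [Finset.sum_apply, Pi.single_apply]

theorem hasFDerivAt_complexify_comp (hT : IsTubeChart M p f Φ ρ) {q : Fin 3 → ℂ}
    (hq : q ∈ Φ.source) : HasFDerivAt (fun q => complexify A c (Φ q))
      ((complexExtension A.linear).comp (fderiv ℂ Φ q)) q :=
  (hasFDerivAt_complexify A c (Φ q)).comp q (hT.analyticAt q hq).differentiableAt.hasFDerivAt

theorem complexExtension_fderiv_rep (hT : IsTubeChart M p f Φ ρ)
    {L : (Fin 3 → ℝ) →ₗ[ℝ] (Fin 3 → ℝ)} {q : Fin 3 → ℂ} (hq : q ∈ Φ.source) (k : Fin 3) :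
    (complexExtension L).comp (fderiv ℂ Φ q) (-Complex.I • rep (f k) q)
      = ofRealPi (L (Pi.single k 1)) := by
  have hframe : fderiv ℂ Φ q (-Complex.I • rep (f k) q) = ofRealPi (Pi.single k 1) := by
    refine (hT.fderiv_frame q hq k).trans ?_
    ext i
    simp [Pi.single_apply, apply_ite]
  rw [ContinuousLinearMap.comp_apply, hframe, complexExtension_ofRealPi]

theorem exists_affineField_eq (hT : IsTubeChart M p f Φ ρ) {g : HolVectorField p}
    {c : Fin 3 → Fin 3 → ℝ} (hg : ∀ k, ⁅f k, g⁆ = ∑ j, c k j • f j) :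
    ∃ a, hT.affineField a = g := by
  have hp := hT.mem_source
  let G (q : Fin 3 → ℂ) : Fin 3 → ℂ := fderiv ℂ Φ q (rep g q)
  have hG : AnalyticAt ℂ G p :=
    ((hT.analyticAt p hp).fderiv.contDiffAt.clm_apply (analyticAt_rep g).contDiffAt).analyticAt
  let A : (Fin 3 → ℝ) →ᵃ[ℝ] (Fin 3 → ℝ) :=
    (Fintype.linearCombination ℝ c).toAffineMap + AffineMap.const ℝ _ (rePart (G p))
  have hA0 : A 0 = rePart (G p) := by simp [A]
  have hAlin (k : Fin 3) : A.linear (Pi.single k 1) = c k := by simp [A]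
  let d := imPart (G p)
  have hzero : ∀ᶠ q in 𝓝 p, G q - complexify A d (Φ q) = 0 := by
    refine hT.isDualCoframe.eventually_eq_zero (c := 0)
      (hG.sub ((analyticAt_complexify A d _).comp (hT.analyticAt p hp))) ?_ ?_
    · filter_upwards [eventually_all.2 fun k => hT.eventually_fderiv_fderiv_rep (hg k),
        hG.eventually_analyticAt, Φ.open_source.mem_nhds hp] with q hGq hGan hq k
      have hA := hT.hasFDerivAt_complexify_comp (A := A) (c := d) hq
      refine le_of_eq (norm_eq_zero.2 ?_) |>.trans (mul_nonneg le_rfl (norm_nonneg _))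
      rw [(hGan.differentiableAt.hasFDerivAt.fun_sub hA).fderiv]
      have hGk : fderiv ℂ G q (-Complex.I • rep (f k) q) = ofRealPi (c k) := hGq k
      rw [Pi.smul_apply, sub_apply, hGk, hT.complexExtension_fderiv_rep hq, hAlin, sub_self]
    · rw [hT.map_base, complexify_zero, hA0, ofRealPi_rePart_add, sub_self]
  refine ⟨(A, d), eq_of_rep_eventuallyEq ?_⟩
  filter_upwards [hT.rep_affineField, hzero, Φ.open_source.mem_nhds hp] with q hrep hq hqs
  rw [hrep, ← sub_eq_zero.1 hq, hT.fderiv_symm_fderiv hqs]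

theorem finrank_affSymmetriesNear (hT : IsTubeChart M p f Φ ρ) (hst : IsHolSimplyTransitiveAt M p)
    (h : ∀ g ∈ hol M p, ∃ a, hT.affineField a = g) :
    Module.finrank ℝ (affSymmetriesNear ρ 0) = 2 := by
  let T : (affSymmetriesNear ρ 0 × (Fin 3 → ℝ)) →ₗ[ℝ] hol M p :=
    LinearMap.codRestrict (hol M p).toSubmodule
      (hT.affineField ∘ₗ (LinearMap.prodMap (affSymmetriesNear ρ 0).subtype LinearMap.id))
      fun a => hT.affineField_mem_hol_iff.2 a.1.2
  have hinj : Function.Injective T := by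
    rintro ⟨⟨A, hA⟩, c⟩ ⟨⟨B, hB⟩, d⟩ hab
    simpa using hT.affineField_injective (congrArg Subtype.val hab)
  have hsurj : Function.Surjective T := by
    rintro ⟨g, hg⟩
    obtain ⟨⟨A, c⟩, rfl⟩ := h g hg
    exact ⟨(⟨A, hT.affineField_mem_hol_iff.1 hg⟩, c), rfl⟩
  have hrank := (LinearEquiv.ofBijective T ⟨hinj, hsurj⟩).finrank_eq
  rw [Module.finrank_prod, hst.2, Module.finrank_fin_fun] at hrank
  omega

theorem injective_affineEval (hT : IsTubeChart M p f Φ ρ) (hst : IsHolSimplyTransitiveAt M p)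
    (hp : p ∈ M) : Function.Injective (affineEval (affSymmetriesNear ρ 0) 0) := by
  rw [injective_iff_map_eq_zero]
  rintro ⟨A, hA⟩ h0
  have hzero := hst.eq_zero_of_eval_eq_zero hT.isLocalDefiningFunction hp
    (hT.affineField_mem_hol_iff.2 hA) (hT.eval_affineField_eq_zero h0)
  exact Subtype.ext (congrArg Prod.fst (hT.affineField_injective (hzero.trans (map_zero _).symm)))

end IsTubeChart

end AffineSymmetries

section AffineSurface

theorem exists_isConnected_zeroSet {F : Type*} [NormedAddCommGroup F] [NormedSpace ℝ F]
    [CompleteSpace F] {ρ : F → ℝ} {ρ' : F →L[ℝ] ℝ} {x₀ : F} (hρ : HasStrictFDerivAt ρ ρ' x₀)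
    (hρ' : ρ' ≠ 0) (h0 : ρ x₀ = 0) {s : Set F} (hs : s ∈ 𝓝 x₀) :
    ∃ O ⊆ s, IsOpen O ∧ x₀ ∈ O ∧ IsConnected {x ∈ O | ρ x = 0} := by
  obtain ⟨n, hn⟩ := exists_apply_eq_one hρ'
  obtain ⟨Ψ, hx₀, hΨ, -⟩ := exists_straightening hρ hn
  have hsymm : Tendsto Ψ.symm (𝓝 (Ψ x₀)) (𝓝 x₀) := by
    simpa only [Ψ.left_inv hx₀] using (Ψ.symm.continuousAt (Ψ.map_source hx₀)).tendsto
  obtain ⟨δ, hδ, hball⟩ := Metric.eventually_nhds_iff_ball.1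
    ((Ψ.open_target.eventually_mem (Ψ.map_source hx₀)).and (hsymm.eventually hs))
  let O := Ψ.source ∩ Ψ ⁻¹' Metric.ball (Ψ x₀) δ
  have hmem : x₀ ∈ O := ⟨hx₀, Metric.mem_ball_self hδ⟩
  have himage : {x ∈ O | ρ x = 0} = Ψ.symm '' (Metric.ball (Ψ x₀) δ ∩ {y | ρ' y = 0}) := by
    ext x
    constructor
    · rintro ⟨⟨hx, hxδ⟩, hρx⟩
      exact ⟨Ψ x, ⟨hxδ, (hΨ x).trans hρx⟩, Ψ.left_inv hx⟩
    · rintro ⟨y, ⟨hyδ, hy⟩, rfl⟩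
      have hyt := (hball y hyδ).1
      refine ⟨⟨Ψ.map_target hyt, ?_⟩, ?_⟩
      · rwa [Set.mem_preimage, Ψ.right_inv hyt]
      · rwa [← hΨ, Ψ.right_inv hyt]
  refine ⟨O, fun x hx => Ψ.left_inv hx.1 ▸ (hball _ hx.2).2,
    Ψ.isOpen_inter_preimage Metric.isOpen_ball, hmem, ⟨x₀, hmem, h0⟩, ?_⟩
  rw [himage]
  refine ((convex_ball _ _).inter ?_).isPreconnected.image _
    (Ψ.continuousOn_symm.mono fun y hy => (hball y hy.1).1)
  exact (LinearMap.ker (ρ' : F →ₗ[ℝ] ℝ)).convex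

variable {E : Type*} [NormedAddCommGroup E] [NormedSpace ℝ E]

theorem eventually_forall_mem_affSymmetriesNear [FiniteDimensional ℝ E] (ρ : E → ℝ) (x₀ : E) :
    ∀ᶠ x in 𝓝 x₀, ρ x = 0 → ∀ A ∈ affSymmetriesNear ρ x₀, fderiv ℝ ρ x (A x) = 0 := by
  let b := Module.finBasis ℝ (affSymmetriesNear ρ x₀)
  filter_upwards [eventually_all.2 fun i => mem_affSymmetriesNear_iff.1 (b i).2] with x hx h0 A hA
  have hzero : (fderiv ℝ ρ x : E →ₗ[ℝ] ℝ) ∘ₗ affineEval (affSymmetriesNear ρ x₀) x = 0 :=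
    b.ext fun i => hx i h0
  exact LinearMap.congr_fun hzero ⟨A, hA⟩

theorem eventually_injective_affineEval [FiniteDimensional ℝ E] {V : Submodule ℝ (E →ᵃ[ℝ] E)}
    {x₀ : E} (h : Function.Injective (affineEval V x₀)) :
    ∀ᶠ x in 𝓝 x₀, Function.Injective (affineEval V x) := by
  let b := Module.finBasis ℝ V
  have hli : LinearIndependent ℝ (affineEval V x₀ ∘ b) :=
    b.linearIndependent.map' _ (LinearMap.ker_eq_bot.2 h)
  have hcont : Continuous fun x => affineEval V x ∘ b :=
    continuous_pi fun i => AffineMap.continuous_of_finiteDimensional (b i).1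
  filter_upwards [hcont.continuousAt.eventually
    (isOpen_setOfPred_linearIndependent.mem_nhds hli)] with x hx
  rw [← LinearMap.ker_eq_bot, ← b.constr_self ℝ (affineEval V x), LinearMap.ker_eq_bot]
  exact b.injective_constr_of_linearIndependent hx

theorem isLocalDefiningFunction_zeroSet {ρ : E → ℝ} {O : Set E} {x : E} (hO : IsOpen O)
    (hx : x ∈ O) (hρ : AnalyticAt ℝ ρ x) (hρ' : fderiv ℝ ρ x ≠ 0) :
    IsLocalDefiningFunction {x ∈ O | ρ x = 0} x ρ := by
  refine ⟨hρ, hρ', ?_⟩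
  filter_upwards [hO.mem_nhds hx] with y hy using and_iff_right hy

theorem affSymmetries_eq_affSymmetriesNear {ρ : (Fin 3 → ℝ) → ℝ} {O : Set (Fin 3 → ℝ)}
    {x₀ : Fin 3 → ℝ} (hO : IsOpen O) (hx₀ : x₀ ∈ O)
    (hdef : ∀ x ∈ O, IsLocalDefiningFunction {x ∈ O | ρ x = 0} x ρ)
    (htan : ∀ x ∈ O, ρ x = 0 → ∀ A ∈ affSymmetriesNear ρ x₀, fderiv ℝ ρ x (A x) = 0) :
    affSymmetries {x ∈ O | ρ x = 0} = affSymmetriesNear ρ x₀ := by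
  refine le_antisymm (fun A hA => ?_) fun A hA x hx =>
    ((hdef x hx.1).mem_tangentSpaceAt_iff hx).2 (htan x hx.1 hx.2 A hA)
  rw [mem_affSymmetriesNear_iff]
  filter_upwards [hO.mem_nhds hx₀] with x hx hρx
  exact ((hdef x hx).mem_tangentSpaceAt_iff ⟨hx, hρx⟩).1 (hA x ⟨hx, hρx⟩)

theorem exists_apply_eq_of_mem_tangentSpaceAt [FiniteDimensional ℝ E]
    {V : Submodule ℝ (E →ᵃ[ℝ] E)} {S : Set E} {ρ : E → ℝ} {x v : E}
    (hρ : IsLocalDefiningFunction S x ρ) (hx : x ∈ S)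
    (hV : ∀ A ∈ V, fderiv ℝ ρ x (A x) = 0) (hinj : Function.Injective (affineEval V x))
    (hdim : Module.finrank ℝ V + 1 = Module.finrank ℝ E) (hv : v ∈ tangentSpaceAt S x) :
    ∃ A ∈ V, A x = v := by
  let ev : V →ₗ[ℝ] tangentSpaceAt S x :=
    (affineEval V x).codRestrict _ fun A => (hρ.mem_tangentSpaceAt_iff hx).2 (hV A.1 A.2)
  have hev : Function.Injective ev := fun A B h => hinj (congrArg Subtype.val h)
  have hrank : Module.finrank ℝ V = Module.finrank ℝ (tangentSpaceAt S x) :=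
    Nat.add_right_cancel (hdim.trans (hρ.finrank_tangentSpaceAt hx).symm)
  obtain ⟨A, hA⟩ :=
    (LinearMap.injective_iff_surjective_of_finrank_eq_finrank hrank).1 hev ⟨v, hv⟩
  exact ⟨A.1, A.2, congrArg Subtype.val hA⟩

theorem exists_isAffSimplyTransitive {ρ : (Fin 3 → ℝ) → ℝ} {x₀ : Fin 3 → ℝ}
    (hρ : AnalyticAt ℝ ρ x₀) (hρ' : fderiv ℝ ρ x₀ ≠ 0) (h0 : ρ x₀ = 0)
    (hdim : Module.finrank ℝ (affSymmetriesNear ρ x₀) = 2)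
    (hinj : Function.Injective (affineEval (affSymmetriesNear ρ x₀) x₀)) :
    ∃ O, IsOpen O ∧ x₀ ∈ O ∧ IsConnected {x ∈ O | ρ x = 0} ∧
      IsAnalyticHypersurface {x ∈ O | ρ x = 0} ∧ IsAffSimplyTransitive {x ∈ O | ρ x = 0} := by
  obtain ⟨O, hOs, hO, hx₀, hconn⟩ := exists_isConnected_zeroSet hρ.hasStrictFDerivAt hρ' h0
    (hρ.eventually_analyticAt.and ((hρ.fderiv.continuousAt.eventually_ne hρ').and
      ((eventually_forall_mem_affSymmetriesNear ρ x₀).and (eventually_injective_affineEval hinj))))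
  have hdef (x) (hx : x ∈ O) : IsLocalDefiningFunction {x ∈ O | ρ x = 0} x ρ :=
    isLocalDefiningFunction_zeroSet hO hx (hOs hx).1 (hOs hx).2.1
  have htan (x) (hx : x ∈ O) := (hOs hx).2.2.1
  have haff := affSymmetries_eq_affSymmetriesNear hO hx₀ hdef htan
  refine ⟨O, hO, hx₀, hconn, fun x hx => ⟨ρ, hdef x hx.1⟩, fun x hx v hv => ?_, haff ▸ hdim⟩
  rw [haff]
  exact exists_apply_eq_of_mem_tangentSpaceAt (hdef x hx.1) hx (htan x hx.1 hx.2)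
    (hOs hx.1).2.2.2 (by rw [hdim, Module.finrank_fin_fun]) hv

theorem IsTubeChart.isLocallyBiholomorphicAt {M : Set (Fin 3 → ℂ)} {p : Fin 3 → ℂ}
    {f : Fin 3 → HolVectorField p} {Φ : OpenPartialHomeomorph (Fin 3 → ℂ) (Fin 3 → ℂ)}
    {ρ : (Fin 3 → ℝ) → ℝ} (hT : IsTubeChart M p f Φ ρ) {O : Set (Fin 3 → ℝ)} (hO : IsOpen O)
    (h0 : 0 ∈ O) : IsLocallyBiholomorphicAt M (tubeOver {x ∈ O | ρ x = 0}) p := by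
  obtain ⟨U, hU, hUo, hpU⟩ := eventually_nhds_iff.1
    (hT.mem_iff.and (hT.tendsto_rePart.eventually (hO.eventually_mem h0)))
  let φ := Φ.restrOpen U hUo
  have hmem (q) (hq : q ∈ φ.source) : q ∈ M ↔ φ q ∈ tubeOver {x ∈ O | ρ x = 0} :=
    (hU q hq.2).1.trans (and_iff_right (hU q hq.2).2).symm
  refine ⟨φ, ⟨hT.mem_source, hpU⟩,
    fun q hq => (hT.analyticAt q hq.1).differentiableAt.differentiableWithinAt,
    fun z hz => (hT.analyticAt_symm z hz.1).differentiableAt.differentiableWithinAt, ?_⟩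
  rw [Set.inter_comm, Set.inter_comm _ φ.target]
  exact OpenPartialHomeomorph.IsImage.image_eq fun q hq => (hmem q hq).symm

end AffineSurface

theorem corollary5p3_general {M : Set (Fin 3 → ℂ)} {p : Fin 3 → ℂ}
    (hst : IsHolSimplyTransitiveAt M p) (hL : IsLeviNondegenerateAt M p) (hp : p ∈ M)
    (hideal : ∃ 𝔞 : LieIdeal ℝ (hol M p), IsLieAbelian 𝔞 ∧ Module.finrank ℝ 𝔞 = 3) :
    ∃ S : Set (Fin 3 → ℝ), IsConnected S ∧ IsAnalyticHypersurface S ∧ IsAffSimplyTransitive S ∧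
      IsLocallyBiholomorphicAt M (tubeOver S) p := by
  obtain ⟨𝔞, _, hdim⟩ := hideal
  obtain ⟨r, hr, hL⟩ := hL.exists_leviForm_ne_zero
  obtain ⟨A, hA, hdimA⟩ := exists_isAbelianIdealOf 𝔞
  have : Module.Finite ℝ A := Module.finite_of_finrank_pos (by omega)
  let b := Module.finBasisOfFinrankEq ℝ A (hdimA.trans hdim)
  have hli : LinearIndependent ℂ fun j => HolVectorField.eval (b j).1 :=
    hA.linearIndependent_eval hst hr hp hL (fun j => (b j).2)
      (b.linearIndependent.map' A.subtype A.ker_subtype)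
  obtain ⟨Φ, ρ, hT⟩ := exists_isTubeChart hr hp (fun j => hA.le (b j).2)
    (fun i j => hA.lie_eq_zero _ (b i).2 _ (b j).2) hli
  have haff (g : HolVectorField p) (hg : g ∈ hol M p) : ∃ a, hT.affineField a = g :=
    let ⟨_, hc⟩ := hA.exists_lie_eq_sum b hg
    hT.exists_affineField_eq hc
  obtain ⟨O, hO, h0, hconn, hsurf, htrans⟩ := exists_isAffSimplyTransitive hT.analyticAt_base
    hT.fderiv_base (hT.base_zero hp) (hT.finrank_affSymmetriesNear hst haff)
    (hT.injective_affineEval hst hp)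
  exact ⟨_, hconn, hsurf, htrans, hT.isLocallyBiholomorphicAt hO h0⟩

theorem corollary5p3 (M : Set (Fin 3 → ℂ)) (hM : IsAnalyticHypersurface M)
    (hst : IsHolSimplyTransitive M) (hLevi : ∀ q ∈ M, IsLeviNondegenerateAt M q)
    (p : Fin 3 → ℂ) (hp : p ∈ M)
    (hideal : ∃ 𝔞 : LieIdeal ℝ (hol M p), IsLieAbelian 𝔞 ∧ Module.finrank ℝ 𝔞 = 3) :
    ∃ S : Set (Fin 3 → ℝ), IsConnected S ∧ IsAnalyticHypersurface S ∧ IsAffSimplyTransitive S ∧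
      IsLocallyBiholomorphicAt M (tubeOver S) p :=
  corollary5p3_general (hst p hp) (hLevi p hp) hp hideal
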